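/- **Conventions.** For a topological space $X$, let $x\le y$ in the specialization order mean that every open set containing $x$ contains $y$. A nonempty $F\subseteq X$ is a *filter* if any $x,y\in F$ have a lower bound in $F$. Let $\mathsf{KOF}(X)$ be the set of compact open filters of $X$, let $\mathsf{fsat}(A)$ be the intersection of all open filters containing $A$, and let $\mathsf{FSat}(X)$ be the complete lattice of fixpoints of $\mathsf{fsat}$ (meets are intersections and $\bigvee\mathcal S=\mathsf{fsat}(\bigcup\mathcal S)$). Finite intersections, unions and joins include the empty ones. **$\mathsf{JM_{SLat}}$ and $\mathsf{JM}$.** Objects of $\mathsf{JM_{SLat}}$ are the sober spaces $X$ in which $\mathsf{KOF}(X)$ is a basis closed under finite intersections; morphisms are maps $f\colon X\to Y$ with $f^{-1}(U)\in\mathsf{KOF}(X)$ for all $U\in\mathsf{KOF}(Y)$. The subcategory $\mathsf{JM}$ has as objects those $X$ for which $\mathsf{KOF}(X)$ is a bounded sublattice of $\mathsf{FSat}(X)$, and as morphisms those $f$ for which $f^{-1}$ preserves finite joins (in $\mathsf{FSat}$) of compact open filters. **$\mathsf{CG_{SLat}}$ and $\mathsf{CG}$.** For a space $X$ with a fixed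 subbasis $\mathcal K$ and $\mathcal C=(X,\mathcal K)$, let $L\mathcal C=\{X\setminus U: U\in\mathcal K\}$ and $\Delta_{\mathcal C}(Y)=\bigcap\{A\in L\mathcal C: Y\subseteq A\}$; fixpoints of $\Delta_{\mathcal C}$ are called $\Delta_{\mathcal C}$-closed. For a $\Delta_{\mathcal C}$-closed $Y$, a *$Y$-family* is a nonempty $\mathcal Z\subseteq L\mathcal C$ such that for all $A,B\in\mathcal Z$ there are $H\in L\mathcal C$ and $C\in\mathcal Z$ with $Y\subseteq H$ and $A\cap H,\ B\cap H\subseteq C$. The pair $\mathcal C$ is a *CG-space* if (a) $X$ is $T_0$ and $X=\bigcup\mathcal K$; (b) each $U\in\mathcal K$ is compact open, and $\mathcal K$ is closed under finite unions; (c) if $U,V\in\mathcal K$ and $x\in U\cap V$, there are $W,D\in\mathcal K$ with $x\in D\setminus W$ and $D\subseteq(U\cap V)\cup W$; (d) if $Y$ is $\Delta_{\mathcal C}$-closed and $\mathcal Z$ is a $Y$-family with $Y\setminus A\neq\varnothing$ for all $A\in\mathcal Z$, then $Y\cap\bigcap_{A\in\mathcal Z}(X\setminus A)\ne\varnothing$.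 For a relation $S\subseteq X_1\times X_2$ put $S[x]=\{y: x\mathrel S y\}$, $S^{-1}[V]=\{x: S[x]\cap V\ne\varnothing\}$ and $\Box_S B=\{x: S[x]\subseteq B\}$. It is a *CG-morphism* $\mathcal C_1\to\mathcal C_2$ if $\Box_SB\in L\mathcal C_1$ for all $B\in L\mathcal C_2$ and every $S[x]$ is $\Delta_{\mathcal C_2}$-closed. CG-spaces and CG-morphisms form the category $\mathsf{CG_{SLat}}$, where for $S_1\colon\mathcal C_1\to\mathcal C_2$ and $S_2\colon\mathcal C_2\to\mathcal C_3$ the composite relates $x$ to $z$ iff, for every $B\in L\mathcal C_3$, $x\in\Box_{S_1}\Box_{S_2}B$ implies $z\in B$, and the identity on $\mathcal C$ is the dual of the specialization order. The subcategory $\mathsf{CG}$ has as objects the CG-spaces with $X\in\mathcal K$ and $\bigcup\{W\in\mathcal K: W\subseteq U\cap V\}\in\mathcal K$ for all $U,V\in\mathcal K$, and as morphisms the CG-morphisms $S$ with $S[x]\neq\varnothing$ for all $x$ and $\Box_S\Delta_{\mathcal C_2}(B_1\cup B_2)\subseteq\Delta_{\mathcal C_1}(\Box_SB_1\cup\Box_SB_2)$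 for all $B_1,B_2\in L\mathcal C_2$. **The functors.** For $X\in\mathsf{JM_{SLat}}$ let $X_m$ be the set of meet-irreducible elements of $X$ for the specialization order (elements $x$ that are not the top and such that $x=y\wedge z$ implies $x=y$ or $x=z$), let $\mathcal K_X=\{X_m\setminus U: U\in\mathsf{KOF}(X)\}$, and give $X_m$ the topology with subbasis $\mathcal K_X$; let $\mathbb M(X)=(X_m,\mathcal K_X)$. For $f\colon X\to Y$ let $\mathbb M(f)=S_f\subseteq X_m\times Y_m$, where $x\mathrel{S_f}y\iff f(x)\le y$. For a CG-space $\mathcal C=(X,\mathcal K)$ let $\mathbb H(\mathcal C)$ be the set of all unions of subfamilies of $\mathcal K$, with the topology generated by the sets $\Psi_U=\{H: U\subseteq H\}$, $U\in\mathcal K$. For a CG-morphism $S\colon\mathcal C_1\to\mathcal C_2$ let $\mathbb H(S)=f_S$, where $f_S(H)=\bigcup\{V\in\mathcal K_2: S^{-1}[V]\subseteq H\}$. **Theorem.** $\mathbb M\colon\mathsf{JM_{SLat}}\to\mathsf{CG_{SLat}}$ and $\mathbb H\colon\mathsf{CG_{SLat}}\to\mathsf{JM_{SLat}}$ are functors,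 they restrict to functors $\mathsf{JM}\to\mathsf{CG}$ and $\mathsf{CG}\to\mathsf{JM}$, and these restrictions form an equivalence of categories between $\mathsf{CG}$ and $\mathsf{JM}$. -/

import Mathlib

open CategoryTheory TopologicalSpace

universe u

namespace CGJM

/-! ### Non-full subcategories and restriction of functors -/

/-- A (not necessarily full) subcategory of `C`: a class of objects, and a class of morphisms between
these objects that contains the identities and is closed under composition.  Only the values
of `hom` on morphisms between objects of the class matter. -/
structure Subcat (C : Type*) [Category C] where
  obj : C → Prop
  hom : ∀ {X Y : C}, (X ⟶ Y) → Prop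
  id_mem : ∀ {X : C}, obj X → hom (𝟙 X)
  comp_mem : ∀ {X Y Z : C}, obj X → obj Y → obj Z → ∀ (f : X ⟶ Y) (g : Y ⟶ Z),
    hom f → hom g → hom (f ≫ g)

/-- The objects of the subcategory `S`. -/
structure Subcat.Obj {C : Type*} [Category C] (S : Subcat C) where
  val : C
  property : S.obj val

instance Subcat.category {C : Type*} [Category C] (S : Subcat C) : Category S.Obj where
  Hom X Y := {f : X.val ⟶ Y.val // S.hom f}
  id X := ⟨𝟙 X.val, S.id_mem X.property⟩
  comp {X Y Z} f g :=
    ⟨f.1 ≫ g.1, S.comp_mem X.property Y.property Z.property f.1 g.1 f.2 g.2⟩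
  id_comp f := Subtype.ext (Category.id_comp f.1)
  comp_id f := Subtype.ext (Category.comp_id f.1)
  assoc f g h := Subtype.ext (Category.assoc f.1 g.1 h.1)

/-- The functor `F : C ⥤ D` maps objects and morphisms of the subcategory `S` into the
subcategory `T`. -/
structure RestrictsTo {C D : Type*} [Category C] [Category D] (F : C ⥤ D)
    (S : Subcat C) (T : Subcat D) : Prop where
  obj : ∀ X : C, S.obj X → T.obj (F.obj X)
  hom : ∀ {X Y : C} (f : X ⟶ Y), S.obj X → S.obj Y → S.hom f → T.hom (F.map f)

/-- The restriction of a functor to subcategories. -/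
def restrict {C D : Type*} [Category C] [Category D] (F : C ⥤ D)
    {S : Subcat C} {T : Subcat D} (h : RestrictsTo F S T) : S.Obj ⥤ T.Obj where
  obj X := ⟨F.obj X.val, h.obj X.val X.property⟩
  map {X Y} f := ⟨F.map f.1, h.hom f.1 X.property Y.property f.2⟩
  map_id X := Subtype.ext (F.map_id X.val)
  map_comp f g := Subtype.ext (F.map_comp f.1 g.1)

/-! ### Jipsen–Moshier spaces -/

/-- The specialization order: `x ≤ y` iff every open set containing `x` contains `y`. -/
def SpecLE {X : Type u} [TopologicalSpace X] (x y : X) : Prop := y ⤳ x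

/-- A nonempty subset that is down-directed in the specialization order. -/
def IsSpecFilter {X : Type u} [TopologicalSpace X] (F : Set X) : Prop :=
  F.Nonempty ∧ ∀ x ∈ F, ∀ y ∈ F, ∃ z ∈ F, SpecLE z x ∧ SpecLE z y

/-- The open filters of `X`. -/
def OF (X : Type u) [TopologicalSpace X] : Set (Set X) :=
  {U | IsOpen U ∧ IsSpecFilter U}

/-- The compact open filters of `X`. -/
def KOF (X : Type u) [TopologicalSpace X] : Set (Set X) :=
  {U | IsCompact U ∧ U ∈ OF X}

/-- The closure operator `fsat`.  Its fixpoints form the complete lattice `FSat X`, in which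
meets are intersections, the join of a family `𝒮` is `fsat (⋃₀ 𝒮)`, the top is `Set.univ` and
the bottom is `fsat ∅`. -/
def fsat {X : Type u} [TopologicalSpace X] (A : Set X) : Set X :=
  ⋂₀ {U | U ∈ OF X ∧ A ⊆ U}

/-- JM-spaces: sober spaces in which the compact open filters form a basis that is closed
under finite intersections (including the empty one). -/
structure IsJMSpace (X : Type u) [TopologicalSpace X] : Prop where
  t0 : T0Space X
  quasiSober : QuasiSober X
  basis : IsTopologicalBasis (KOF X)
  sInter_mem : ∀ 𝒮 : Set (Set X), 𝒮.Finite → 𝒮 ⊆ KOF X → ⋂₀ 𝒮 ∈ KOF X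

/-- `KOF X` is a bounded sublattice of `FSat X`. -/
structure KOFBoundedSublattice (X : Type u) [TopologicalSpace X] : Prop where
  top_mem : Set.univ ∈ KOF X
  bot_mem : fsat ∅ ∈ KOF X
  inf_mem : ∀ U ∈ KOF X, ∀ V ∈ KOF X, U ∩ V ∈ KOF X
  sup_mem : ∀ U ∈ KOF X, ∀ V ∈ KOF X, fsat (U ∪ V) ∈ KOF X

/-- The objects of the category `JM_SLat`. -/
structure JMSLat : Type (u + 1) where
  carrier : Type u
  [top : TopologicalSpace carrier]
  isJM : IsJMSpace carrier

attribute [instance] JMSLat.top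

/-- The morphisms of `JM_SLat`: maps that pull compact open filters back to compact open
filters. -/
@[ext]
structure JMSLat.Hom (X Y : JMSLat.{u}) where
  toFun : X.carrier → Y.carrier
  preimage_mem : ∀ U ∈ KOF Y.carrier, toFun ⁻¹' U ∈ KOF X.carrier

instance : Category JMSLat.{u} where
  Hom X Y := JMSLat.Hom X Y
  id X := ⟨fun x => x, fun _ hU => hU⟩
  comp f g := ⟨fun x => g.toFun (f.toFun x),
    fun U hU => f.preimage_mem _ (g.preimage_mem U hU)⟩

/-- `f⁻¹` preserves finite joins (taken in `FSat`) of compact open filters, including the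
empty join. -/
def PreservesFiniteJoins {X Y : JMSLat.{u}} (f : X ⟶ Y) : Prop :=
  ∀ 𝒮 : Set (Set Y.carrier), 𝒮.Finite → 𝒮 ⊆ KOF Y.carrier →
    f.toFun ⁻¹' fsat (⋃₀ 𝒮) = fsat (⋃₀ (Set.preimage f.toFun '' 𝒮))

/-- The category `JM`, as a (non-full) subcategory of `JM_SLat`. -/
def JM : Subcat JMSLat.{u} where
  obj X := KOFBoundedSublattice X.carrier
  hom f := PreservesFiniteJoins f
  id_mem {X} _ 𝒮 _ _ := by
    have h : Set.preimage (JMSLat.Hom.toFun (𝟙 X)) '' 𝒮 = 𝒮 := Set.image_id 𝒮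
    rw [h]
    rfl
  comp_mem {X Y Z} _ _ _ f g hf hg 𝒮 hfin hsub := by
    have h1 := hg 𝒮 hfin hsub
    have h2 := hf (Set.preimage g.toFun '' 𝒮) (hfin.image _) (by
      rintro _ ⟨U, hU, rfl⟩
      exact g.preimage_mem U (hsub hU))
    rw [Set.image_image] at h2
    change f.toFun ⁻¹' (g.toFun ⁻¹' fsat (⋃₀ 𝒮)) = _
    rw [h1, h2]
    rfl

/-! ### Celani–González spaces -/

/-- A topological space together with a distinguished family `K` of subsets. -/
structure SubbasicSpace : Type (u + 1) where
  carrier : Type u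
  [top : TopologicalSpace carrier]
  K : Set (Set carrier)

attribute [instance] SubbasicSpace.top

namespace SubbasicSpace

/-- The family of complements of the members of `K`. -/
def L (C : SubbasicSpace.{u}) : Set (Set C.carrier) := {B | Bᶜ ∈ C.K}

/-- The closure operator `Δ`. -/
def delta (C : SubbasicSpace.{u}) (Y : Set C.carrier) : Set C.carrier :=
  ⋂₀ {A | A ∈ C.L ∧ Y ⊆ A}

/-- The fixpoints of `Δ`. -/
def IsDeltaClosed (C : SubbasicSpace.{u}) (Y : Set C.carrier) : Prop := C.delta Y = Y

/-- `Y`-families; they are nonempty by convention (for `Y = ∅` and the empty family, axiom `d`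
of CG-spaces could never hold, because `∅` is always `Δ`-closed). -/
def IsFamily (C : SubbasicSpace.{u}) (Y : Set C.carrier) (𝒵 : Set (Set C.carrier)) : Prop :=
  𝒵.Nonempty ∧ 𝒵 ⊆ C.L ∧
    ∀ A ∈ 𝒵, ∀ B ∈ 𝒵, ∃ H ∈ C.L, ∃ D ∈ 𝒵, Y ⊆ H ∧ A ∩ H ⊆ D ∧ B ∩ H ⊆ D

/-- CG-spaces. -/
structure IsCGSpace (C : SubbasicSpace.{u}) : Prop where
  subbasis : C.top = generateFrom C.K
  t0 : T0Space C.carrier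
  sUnion_K : ⋃₀ C.K = Set.univ
  isOpen : ∀ U ∈ C.K, IsOpen U
  isCompact : ∀ U ∈ C.K, IsCompact U
  sUnion_mem : ∀ 𝒮 : Set (Set C.carrier), 𝒮.Finite → 𝒮 ⊆ C.K → ⋃₀ 𝒮 ∈ C.K
  c : ∀ U ∈ C.K, ∀ V ∈ C.K, ∀ x ∈ U ∩ V,
    ∃ W ∈ C.K, ∃ D ∈ C.K, x ∈ D \ W ∧ D ⊆ (U ∩ V) ∪ W
  d : ∀ (Y : Set C.carrier) (𝒵 : Set (Set C.carrier)), C.IsDeltaClosed Y → C.IsFamily Y 𝒵 →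
    (∀ A ∈ 𝒵, (Y \ A).Nonempty) → (Y ∩ ⋂ A ∈ 𝒵, Aᶜ).Nonempty

end SubbasicSpace

/-- `□_S B = {x | S[x] ⊆ B}`. -/
def box {X Y : Type u} (S : X → Y → Prop) (B : Set Y) : Set X :=
  {x | ∀ y, S x y → y ∈ B}

/-- CG-morphisms. -/
structure IsCGMorphism (C₁ C₂ : SubbasicSpace.{u}) (S : C₁.carrier → C₂.carrier → Prop) :
    Prop where
  box_mem : ∀ B ∈ C₂.L, box S B ∈ C₁.L
  isDeltaClosed : ∀ x, C₂.IsDeltaClosed {y | S x y}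

/-- The composition `S₂ ⋆ S₁` of relations between spaces, the last of which is `C₃`. -/
def starComp {X Y : Type u} (C₃ : SubbasicSpace.{u}) (S₁ : X → Y → Prop)
    (S₂ : Y → C₃.carrier → Prop) (x : X) (z : C₃.carrier) : Prop :=
  ∀ B ∈ C₃.L, x ∈ box S₁ (box S₂ B) → z ∈ B

/-- The identity CG-morphism: the dual of the specialization order. -/
def idRel (C : SubbasicSpace.{u}) (x y : C.carrier) : Prop := SpecLE y x

theorem box_mono {X Y : Type u} (S : X → Y → Prop) {B B' : Set Y} (h : B ⊆ B') :
    box S B ⊆ box S B' := fun _ hx y hy => h (hx y hy)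

theorem SubbasicSpace.subset_delta (C : SubbasicSpace.{u}) (Y : Set C.carrier) :
    Y ⊆ C.delta Y := fun _ hy _ hA => hA.2 hy

/-- In a CG-space, `Δ`-closed sets generated by filters of `L` determine these filters. -/
theorem SubbasicSpace.IsCGSpace.mem_of_sInter_subset {C : SubbasicSpace.{u}} (hC : C.IsCGSpace)
    {F : Set (Set C.carrier)} (hF : F ⊆ C.L)
    (hfin : ∀ 𝒯 : Set (Set C.carrier), 𝒯.Finite → 𝒯 ⊆ F → ∀ B ∈ C.L, ⋂₀ 𝒯 ⊆ B → B ∈ F)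
    {B : Set C.carrier} (hB : B ∈ C.L) (h : ⋂₀ F ⊆ B) : B ∈ F := by
  have hcov : Bᶜ ⊆ ⋃ A ∈ F, Aᶜ := by
    intro x hx
    by_contra hne
    refine hx (h fun A hA => ?_)
    by_contra hxA
    exact hne (Set.mem_biUnion hA hxA)
  obtain ⟨𝒯, hTF, hTfin, hT⟩ := (hC.isCompact _ hB).elim_finite_subcover_image
    (fun A hA => hC.isOpen _ (hF hA)) hcov
  refine hfin 𝒯 hTfin hTF B hB fun x hx => ?_
  by_contra hxB
  obtain ⟨A, hA, hxA⟩ := Set.mem_iUnion₂.mp (hT hxB)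
  exact hxA (hx A hA)

/-- The key property of `⋆`. -/
theorem box_starComp {C₁ C₂ C₃ : SubbasicSpace.{u}} (h₃ : C₃.IsCGSpace)
    (S₁ : C₁.carrier → C₂.carrier → Prop) (S₂ : C₂.carrier → C₃.carrier → Prop)
    {B : Set C₃.carrier} (hB : B ∈ C₃.L) :
    box (starComp C₃ S₁ S₂) B = box S₁ (box S₂ B) := by
  ext x
  constructor
  · intro hx
    have key := h₃.mem_of_sInter_subset (F := {B | B ∈ C₃.L ∧ x ∈ box S₁ (box S₂ B)})
      (fun _ h => h.1) (by
        intro 𝒯 _ hTF B' hB' hsub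
        refine ⟨hB', fun y hy z hz => hsub fun T hT => (hTF hT).2 y hy z hz⟩) hB
      (fun z hz => hx z fun B' hB' hxB' => hz B' ⟨hB', hxB'⟩)
    exact key.2
  · intro hx z hz
    exact hz B hB hx

/-- A CG-morphism is determined by its box operator. -/
theorem IsCGMorphism.rel_iff {C₁ C₂ : SubbasicSpace.{u}} {S : C₁.carrier → C₂.carrier → Prop}
    (hS : IsCGMorphism C₁ C₂ S) (x : C₁.carrier) (y : C₂.carrier) :
    S x y ↔ ∀ B ∈ C₂.L, x ∈ box S B → y ∈ B := by
  constructor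
  · intro h B _ hx
    exact hx y h
  · intro h
    have h2 : y ∈ C₂.delta {y | S x y} := fun A hA => h A hA.1 hA.2
    rw [hS.isDeltaClosed x] at h2
    exact h2

theorem starComp_isCGMorphism {C₁ C₂ C₃ : SubbasicSpace.{u}} (h₃ : C₃.IsCGSpace)
    {S₁ : C₁.carrier → C₂.carrier → Prop} {S₂ : C₂.carrier → C₃.carrier → Prop}
    (hS₁ : IsCGMorphism C₁ C₂ S₁) (hS₂ : IsCGMorphism C₂ C₃ S₂) :
    IsCGMorphism C₁ C₃ (starComp C₃ S₁ S₂) where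
  box_mem B hB := by
    rw [box_starComp h₃ S₁ S₂ hB]
    exact hS₁.box_mem _ (hS₂.box_mem B hB)
  isDeltaClosed x := by
    refine Set.Subset.antisymm (fun z hz B hB hx => hz B ⟨hB, fun z' hz' => hz' B hB hx⟩) ?_
    exact C₃.subset_delta _

theorem box_idRel {C : SubbasicSpace.{u}} (hC : C.IsCGSpace) {B : Set C.carrier}
    (hB : B ∈ C.L) : box (idRel C) B = B := by
  ext x
  constructor
  · intro hx
    exact hx x (specializes_refl x)
  · intro hx y hy
    by_contra hyB
    exact (Specializes.mem_open hy (hC.isOpen _ hB) hyB) hx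

theorem idRel_isCGMorphism {C : SubbasicSpace.{u}} (hC : C.IsCGSpace) :
    IsCGMorphism C C (idRel C) where
  box_mem B hB := by rwa [box_idRel hC hB]
  isDeltaClosed x := by
    refine Set.Subset.antisymm (fun y hy => ?_) (C.subset_delta _)
    have h : ∀ U ∈ C.K, y ∈ U → x ∈ U := by
      intro U hU hyU
      by_contra hxU
      have hB : Uᶜ ∈ C.L := by simpa [SubbasicSpace.L] using hU
      have hx : x ∈ box (idRel C) Uᶜ := by
        rw [box_idRel hC hB]
        exact hxU
      exact hy Uᶜ ⟨hB, hx⟩ hyU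
    change x ⤳ y
    rw [specializes_iff_forall_open]
    intro s hs hys
    rw [hC.subbasis] at hs
    induction hs with
    | basic s hs => exact h s hs hys
    | univ => exact Set.mem_univ x
    | inter s t _ _ ihs iht => exact ⟨ihs hys.1, iht hys.2⟩
    | sUnion 𝒮 _ ih =>
      obtain ⟨s, hs, hy⟩ := hys
      exact ⟨s, hs, ih s hs hy⟩

/-- The objects of the category `CG_SLat`. -/
structure CGSLat : Type (u + 1) where
  space : SubbasicSpace.{u}
  isCG : space.IsCGSpace

/-- The morphisms of `CG_SLat`. -/
@[ext]
structure CGSLat.Hom (C₁ C₂ : CGSLat.{u}) where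
  rel : C₁.space.carrier → C₂.space.carrier → Prop
  isCG : IsCGMorphism C₁.space C₂.space rel

/-- CG-morphisms with the same box operator are equal. -/
theorem CGSLat.Hom.ext_box {C₁ C₂ : CGSLat.{u}} {S T : CGSLat.Hom C₁ C₂}
    (h : ∀ B ∈ C₂.space.L, box S.rel B = box T.rel B) : S = T := by
  ext x y
  rw [S.isCG.rel_iff, T.isCG.rel_iff]
  exact forall₂_congr fun B hB => by rw [h B hB]

instance : Category CGSLat.{u} where
  Hom C₁ C₂ := CGSLat.Hom C₁ C₂
  id C := ⟨idRel C.space, idRel_isCGMorphism C.isCG⟩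
  comp {_ _ C₃} S₁ S₂ :=
    ⟨starComp C₃.space S₁.rel S₂.rel, starComp_isCGMorphism C₃.isCG S₁.isCG S₂.isCG⟩
  id_comp {C₁ C₂} S := CGSLat.Hom.ext_box fun B hB => by
    rw [box_starComp C₂.isCG _ _ hB, box_idRel C₁.isCG (S.isCG.box_mem B hB)]
  comp_id {C₁ C₂} S := CGSLat.Hom.ext_box fun B hB => by
    rw [box_starComp C₂.isCG _ _ hB, box_idRel C₂.isCG hB]
  assoc {C₁ C₂ C₃ C₄} S T R := CGSLat.Hom.ext_box fun B hB => by
    rw [box_starComp C₄.isCG _ _ hB, box_starComp C₄.isCG _ _ hB, box_starComp C₄.isCG _ _ hB,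
      box_starComp C₃.isCG _ _ (R.isCG.box_mem B hB)]

/-- The conditions on the objects of `CG`. -/
structure IsCGLatObj (C : SubbasicSpace.{u}) : Prop where
  univ_mem : Set.univ ∈ C.K
  meet_mem : ∀ U ∈ C.K, ∀ V ∈ C.K, ⋃₀ {W | W ∈ C.K ∧ W ⊆ U ∩ V} ∈ C.K

/-- The conditions on the morphisms of `CG`. -/
structure IsCGLatHom (C₁ C₂ : SubbasicSpace.{u}) (S : C₁.carrier → C₂.carrier → Prop) :
    Prop where
  serial : ∀ x, ∃ y, S x y
  box_join : ∀ B₁ ∈ C₂.L, ∀ B₂ ∈ C₂.L,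
    box S (C₂.delta (B₁ ∪ B₂)) ⊆ C₁.delta (box S B₁ ∪ box S B₂)

theorem IsCGLatObj.delta_union_mem {C : SubbasicSpace.{u}} (h : IsCGLatObj C)
    {A B : Set C.carrier} (hA : A ∈ C.L) (hB : B ∈ C.L) : C.delta (A ∪ B) ∈ C.L := by
  have h1 := h.meet_mem _ hA _ hB
  have h2 : (C.delta (A ∪ B))ᶜ = ⋃₀ {W | W ∈ C.K ∧ W ⊆ Aᶜ ∩ Bᶜ} := by
    unfold SubbasicSpace.delta
    rw [Set.compl_sInter]
    congr 1
    ext W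
    constructor
    · rintro ⟨D, ⟨hD, hsub⟩, rfl⟩
      refine ⟨hD, ?_⟩
      rw [← Set.compl_union]
      exact Set.compl_subset_compl.mpr hsub
    · rintro ⟨hW, hsub⟩
      refine ⟨Wᶜ, ⟨?_, ?_⟩, compl_compl W⟩
      · simpa [SubbasicSpace.L] using hW
      · rw [← Set.compl_union] at hsub
        exact Set.subset_compl_comm.mp hsub
  change _ ∈ C.K
  rw [h2]
  exact h1

theorem IsCGLatObj.empty_mem {C : SubbasicSpace.{u}} (h : IsCGLatObj C) : ∅ ∈ C.L := by
  simpa [SubbasicSpace.L] using h.univ_mem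

/-- The category `CG`, as a (non-full) subcategory of `CG_SLat`. -/
def CG : Subcat CGSLat.{u} where
  obj C := IsCGLatObj C.space
  hom {C₁ C₂} S := IsCGLatHom C₁.space C₂.space S.rel
  id_mem {C} hC :=
    { serial := fun x => ⟨x, specializes_refl x⟩
      box_join := fun B₁ h₁ B₂ h₂ => by
        change box (idRel C.space) _ ⊆ C.space.delta (box (idRel C.space) _ ∪ box (idRel C.space) _)
        rw [box_idRel C.isCG h₁, box_idRel C.isCG h₂,
          box_idRel C.isCG (hC.delta_union_mem h₁ h₂)] }
  comp_mem {C₁ C₂ C₃} _ _ h₃ S T hS hT :=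
    { serial := fun x => by
        by_contra hne
        have hx : x ∈ box (starComp C₃.space S.rel T.rel) ∅ := fun z hz => hne ⟨z, hz⟩
        rw [box_starComp C₃.isCG _ _ h₃.empty_mem] at hx
        obtain ⟨y, hy⟩ := hS.serial x
        obtain ⟨z, hz⟩ := hT.serial y
        exact hx y hy z hz
      box_join := fun B₁ hB₁ B₂ hB₂ => by
        change box (starComp C₃.space S.rel T.rel) _ ⊆
          C₁.space.delta (box (starComp C₃.space S.rel T.rel) _ ∪
            box (starComp C₃.space S.rel T.rel) _)
        rw [box_starComp C₃.isCG _ _ hB₁, box_starComp C₃.isCG _ _ hB₂,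
          box_starComp C₃.isCG _ _ (h₃.delta_union_mem hB₁ hB₂)]
        exact (box_mono _ (hT.box_join B₁ hB₁ B₂ hB₂)).trans
          (hS.box_join _ (T.isCG.box_mem _ hB₁) _ (T.isCG.box_mem _ hB₂)) }

/-! ### The functor `M` -/

/-- `x` is not the top, and `x = y ∧ z` implies `x = y` or `x = z`, for the specialization
order. -/
def IsMeetIrreducible {X : Type u} [TopologicalSpace X] (x : X) : Prop :=
  (¬ ∀ y, SpecLE y x) ∧
    ∀ y z : X, SpecLE x y → SpecLE x z → (∀ w, SpecLE w y → SpecLE w z → SpecLE w x) →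
      x = y ∨ x = z

/-- The set `X_m` of meet-irreducible elements with the family
`K_X = {-U ∩ X_m | U ∈ KOF X}` and the topology having `K_X` as a subbasis. -/
def meetIrrSpace (X : Type u) [TopologicalSpace X] : SubbasicSpace.{u} where
  carrier := {x : X // IsMeetIrreducible x}
  top := generateFrom {V | ∃ U ∈ KOF X, V = {x | x.1 ∉ U}}
  K := {V | ∃ U ∈ KOF X, V = {x | x.1 ∉ U}}

/-- The relation `S_f` on meet-irreducible elements: `x S_f y` iff `f x ≤ y`. -/
def relOfMap {X Y : Type u} [TopologicalSpace X] [TopologicalSpace Y] (f : X → Y)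
    (x : (meetIrrSpace X).carrier) (y : (meetIrrSpace Y).carrier) : Prop :=
  SpecLE (f x.1) y.1

/-- `X ↦ (X_m, K_X)`, `f ↦ S_f` is a functor from `JM_SLat` to `CG_SLat`. -/
structure MIsFunctor : Prop where
  obj : ∀ X : JMSLat.{u}, (meetIrrSpace X.carrier).IsCGSpace
  map : ∀ {X Y : JMSLat.{u}} (f : X ⟶ Y),
    IsCGMorphism (meetIrrSpace X.carrier) (meetIrrSpace Y.carrier) (relOfMap f.toFun)
  map_id : ∀ X : JMSLat.{u},
    relOfMap (JMSLat.Hom.toFun (𝟙 X)) = idRel (meetIrrSpace X.carrier)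
  map_comp : ∀ {X Y Z : JMSLat.{u}} (f : X ⟶ Y) (g : Y ⟶ Z),
    relOfMap (JMSLat.Hom.toFun (f ≫ g)) =
      starComp (meetIrrSpace Z.carrier) (relOfMap f.toFun) (relOfMap g.toFun)

/-- The functor `M : JM_SLat ⥤ CG_SLat`. -/
def functorM (h : MIsFunctor.{u}) : JMSLat.{u} ⥤ CGSLat.{u} where
  obj X := ⟨meetIrrSpace X.carrier, h.obj X⟩
  map f := ⟨relOfMap f.toFun, h.map f⟩
  map_id X := CGSLat.Hom.ext (h.map_id X)
  map_comp f g := CGSLat.Hom.ext (h.map_comp f g)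

/-! ### The functor `H` -/

/-- The set of unions of subfamilies of `K`. -/
def HSpace (C : SubbasicSpace.{u}) : Type u :=
  {H : Set C.carrier // ∃ 𝒮 ⊆ C.K, H = ⋃₀ 𝒮}

/-- `Ψ_U = {H | U ⊆ H}`. -/
def Psi (C : SubbasicSpace.{u}) (U : Set C.carrier) : Set (HSpace C) := {H | U ⊆ H.1}

/-- The topology with subbasis `{Ψ_U | U ∈ K}`. -/
instance HSpace.topology (C : SubbasicSpace.{u}) : TopologicalSpace (HSpace C) :=
  generateFrom (Psi C '' C.K)

/-- The map `f_S`, `f_S H = ⋃ {V ∈ K₂ | S⁻¹[V] ⊆ H}`. -/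
def mapOfRel {C₁ C₂ : SubbasicSpace.{u}} (S : C₁.carrier → C₂.carrier → Prop)
    (H : HSpace C₁) : HSpace C₂ :=
  ⟨⋃₀ {V | V ∈ C₂.K ∧ {x | ∃ y ∈ V, S x y} ⊆ H.1}, _, fun _ hV => hV.1, rfl⟩

/-- `C ↦ H(C)`, `S ↦ f_S` is a functor from `CG_SLat` to `JM_SLat`. -/
structure HIsFunctor : Prop where
  obj : ∀ C : CGSLat.{u}, IsJMSpace (HSpace C.space)
  map : ∀ {C₁ C₂ : CGSLat.{u}} (S : C₁ ⟶ C₂), ∀ U ∈ KOF (HSpace C₂.space),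
    mapOfRel S.rel ⁻¹' U ∈ KOF (HSpace C₁.space)
  map_id : ∀ C : CGSLat.{u}, mapOfRel (CGSLat.Hom.rel (𝟙 C)) = fun H => H
  map_comp : ∀ {C₁ C₂ C₃ : CGSLat.{u}} (S : C₁ ⟶ C₂) (T : C₂ ⟶ C₃),
    mapOfRel (CGSLat.Hom.rel (S ≫ T)) = fun H => mapOfRel T.rel (mapOfRel S.rel H)

/-- The functor `H : CG_SLat ⥤ JM_SLat`. -/
def functorH (h : HIsFunctor.{u}) : CGSLat.{u} ⥤ JMSLat.{u} where
  obj C := { carrier := HSpace C.space, isJM := h.obj C }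
  map S := ⟨mapOfRel S.rel, h.map S⟩
  map_id C := JMSLat.Hom.ext (h.map_id C)
  map_comp S T := JMSLat.Hom.ext (h.map_comp S T)

end CGJM

namespace CGJM

/-! ### The specialization order and compact open filters -/

section Spec

variable {X : Type u} [TopologicalSpace X]

/-! Both kinds of space are disguised meet-semilattices. A space in `JM_SLat` is recovered from `KOF
X`: compact open filters are supercompact, so sobriety turns every filter of the semilattice `KOF X`
into a unique point (`IsJMSpace.exists_point`). A CG-morphism is determined by its box operator on
`L`, which turns composition of relations into composition of operators (`box_starComp`).

The two functors transport these data. Zorn's lemma gives enough meet-irreducible points to separate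
any point from any compact open filter avoiding it, so `irrSet` is an order isomorphism from `KOF X`
onto the family `L` of `meetIrrSpace X`. Conversely, compactness of the members of `K` makes them
behave like compact elements, whence `KOF (HSpace C)` consists exactly of the sets `Psi C U` with `U
∈ K` (`HSpace.KOF_eq`). Inverse images and boxes match under these identifications (`box_relOfMap`,
`preimage_mapOfRel_Psi`), and functoriality and naturality reduce to comparing the two.

The axioms of CG-spaces reflect meet-irreducibility: (c) says that a point avoiding two filters
avoids something like their join relative to the point, and (d) is Zorn's lemma for a whole family.

In the bounded lattice case, `fsat (U ∪ V)` and `Δ (A ∪ B)` are the binary joins of `KOF X` and of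
`L`, so the join conditions on the two sides correspond. The unit and counit already exist between
the larger categories; they restrict because isomorphisms between objects of either subcategory
automatically lie in it. -/

theorem SpecLE.refl (x : X) : SpecLE x x := specializes_refl x

theorem SpecLE.trans {x y z : X} (h : SpecLE x y) (h' : SpecLE y z) : SpecLE x z :=
  Specializes.trans h' h

theorem SpecLE.mem_open {x y : X} (h : SpecLE x y) {U : Set X} (hU : IsOpen U) (hx : x ∈ U) :
    y ∈ U :=
  Specializes.mem_open h hU hx

theorem isOpen_of_mem_KOF {U : Set X} (hU : U ∈ KOF X) : IsOpen U := hU.2.1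

theorem SpecLE.mem_KOF {x y : X} (h : SpecLE x y) {U : Set X} (hU : U ∈ KOF X) (hx : x ∈ U) :
    y ∈ U :=
  h.mem_open (isOpen_of_mem_KOF hU) hx

theorem specLE_iff_of_isTopologicalBasis {B : Set (Set X)} (hB : IsTopologicalBasis B) {x y : X} :
    SpecLE x y ↔ ∀ U ∈ B, x ∈ U → y ∈ U := by
  refine ⟨fun h U hU hx => h.mem_open (hB.isOpen hU) hx, fun h => ?_⟩
  change y ⤳ x
  rw [specializes_iff_forall_open]
  intro s hs hx
  obtain ⟨U, hU, hxU, hUs⟩ := hB.exists_subset_of_mem_open hx hs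
  exact hUs (h U hU hxU)

theorem specLE_generateFrom_iff {B : Set (Set X)} (hB : ‹TopologicalSpace X› = generateFrom B)
    {x y : X} : SpecLE x y ↔ ∀ U ∈ B, x ∈ U → y ∈ U := by
  refine ⟨fun h U hU hx => h.mem_open (hB ▸ isOpen_generateFrom_of_mem hU) hx, fun h => ?_⟩
  change y ⤳ x
  rw [specializes_iff_forall_open]
  intro s hs hx
  rw [hB] at hs
  induction hs with
  | basic s hs => exact h s hs hx
  | univ => exact Set.mem_univ _
  | inter s t _ _ ihs iht => exact ⟨ihs hx.1, iht hx.2⟩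
  | sUnion 𝒮 _ ih =>
    obtain ⟨s, hs, hx⟩ := hx
    exact ⟨s, hs, ih s hs hx⟩

/-- Every neighbourhood of the least point contains all of `s`, so every filter on `s` clusters
there. -/
theorem isCompact_of_forall_specLE {s : Set X} {x : X} (hx : x ∈ s) (h : ∀ y ∈ s, SpecLE x y) :
    IsCompact s := by
  intro f _ hf
  refine ⟨x, hx, ClusterPt.of_le_nhds (hf.trans ?_)⟩
  intro N hN
  obtain ⟨t, htN, ht, hxt⟩ := mem_nhds_iff.mp hN
  exact fun y hy => htN ((h y hy).mem_open ht hxt)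

theorem IsSpecFilter.exists_specLE_of_finite {F : Set X} (hF : IsSpecFilter F) {s : Set X}
    (hs : s.Finite) (hsF : s ⊆ F) : ∃ z ∈ F, ∀ x ∈ s, SpecLE z x := by
  induction s, hs using Set.Finite.induction_on with
  | empty =>
    obtain ⟨z, hz⟩ := hF.1
    exact ⟨z, hz, by simp⟩
  | @insert a s _ _ ih =>
    obtain ⟨z, hz, h⟩ := ih ((Set.subset_insert a s).trans hsF)
    obtain ⟨w, hw, hwz, hwa⟩ := hF.2 z hz a (hsF (Set.mem_insert a s))
    refine ⟨w, hw, ?_⟩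
    rintro x (rfl | hx)
    · exact hwa
    · exact hwz.trans (h x hx)

/-- Compact open filters are supercompact. -/
theorem exists_subset_of_subset_sUnion {U : Set X} (hU : U ∈ KOF X) {𝒪 : Set (Set X)}
    (hO : ∀ O ∈ 𝒪, IsOpen O) (h : U ⊆ ⋃₀ 𝒪) : ∃ O ∈ 𝒪, U ⊆ O := by
  by_contra! hne
  obtain ⟨T, hT, hTfin, hUT⟩ := hU.1.elim_finite_subcover_image (b := 𝒪) (c := id) hO
    (by rwa [Set.sUnion_eq_biUnion] at h)
  have : Nonempty X := ⟨hU.2.2.1.some⟩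
  have hch : ∀ O ∈ 𝒪, ∃ x, x ∈ U ∧ x ∉ O := fun O hO => Set.not_subset.mp (hne O hO)
  -- Each member of the finite subcover misses some point of `U`. A common lower bound of these
  -- points in `U` lies in some member, which is upward closed and so contains the point it should
  -- miss.
  choose! p hp using hch
  obtain ⟨z, hz, hzp⟩ := hU.2.2.exists_specLE_of_finite (hTfin.image p)
    (Set.image_subset_iff.mpr fun O hO => (hp O (hT hO)).1)
  obtain ⟨O, hOT, hzO⟩ := Set.mem_iUnion₂.mp (hUT hz)
  exact (hp O (hT hOT)).2 ((hzp _ ⟨O, hOT, rfl⟩).mem_open (hO O (hT hOT)) hzO)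

theorem subset_fsat (A : Set X) : A ⊆ fsat A := fun _ hx _ hU => hU.2 hx

theorem fsat_subset {A U : Set X} (hU : U ∈ OF X) (h : A ⊆ U) : fsat A ⊆ U :=
  fun _ hx => hx U ⟨hU, h⟩

theorem fsat_mono {A B : Set X} (h : A ⊆ B) : fsat A ⊆ fsat B :=
  fun _ hx U hU => hx U ⟨hU.1, h.trans hU.2⟩

theorem fsat_union_fsat (A B : Set X) : fsat (A ∪ fsat B) = fsat (A ∪ B) := by
  refine Set.Subset.antisymm (fun x hx U hU => hx U ⟨hU.1, Set.union_subset ?_ ?_⟩)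
    (fsat_mono (Set.union_subset_union_right A (subset_fsat B)))
  · exact Set.subset_union_left.trans hU.2
  · exact fsat_subset hU.1 (Set.subset_union_right.trans hU.2)

end Spec

/-! ### Points of JM-spaces -/

namespace IsJMSpace

variable {X : Type u} [TopologicalSpace X] (hX : IsJMSpace X)

include hX

theorem univ_mem : Set.univ ∈ KOF X := by
  simpa using hX.sInter_mem ∅ Set.finite_empty (Set.empty_subset _)

theorem inter_mem {U V : Set X} (hU : U ∈ KOF X) (hV : V ∈ KOF X) : U ∩ V ∈ KOF X := by
  have h := hX.sInter_mem {U, V} (Set.toFinite _) (by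
    rintro _ (rfl | rfl)
    exacts [hU, hV])
  simpa using h

theorem specLE_iff {x y : X} : SpecLE x y ↔ ∀ U ∈ KOF X, x ∈ U → y ∈ U :=
  specLE_iff_of_isTopologicalBasis hX.basis

theorem antisymm {x y : X} (h : SpecLE x y) (h' : SpecLE y x) : x = y := by
  have := hX.t0
  exact (Specializes.antisymm h h').eq.symm

theorem ext_KOF {x y : X} (h : ∀ U ∈ KOF X, x ∈ U ↔ y ∈ U) : x = y :=
  hX.antisymm (hX.specLE_iff.mpr fun U hU => (h U hU).mp)
    (hX.specLE_iff.mpr fun U hU => (h U hU).mpr)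

/-- By sobriety, every filter of compact open filters is the neighbourhood filter of a point. -/
theorem exists_point {F : Set (Set X)} (hF : F ⊆ KOF X) (huniv : Set.univ ∈ F)
    (hinter : ∀ U ∈ F, ∀ V ∈ F, U ∩ V ∈ F)
    (hup : ∀ U ∈ F, ∀ V ∈ KOF X, U ⊆ V → V ∈ F) :
    ∃ x : X, ∀ U ∈ KOF X, x ∈ U ↔ U ∈ F := by
  -- By supercompactness, `P` is the largest open set including no member of `F`; its complement is
  -- irreducible, and the required point is generic in it.
  set P : Set X := ⋃₀ {O | IsOpen O ∧ ∀ U ∈ F, ¬ U ⊆ O}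
  have hP : IsOpen P := isOpen_sUnion fun O hO => hO.1
  have hnP : ∀ U ∈ F, ¬ U ⊆ P := by
    intro U hU hUP
    obtain ⟨O, hO, hUO⟩ := exists_subset_of_subset_sUnion (hF hU) (fun O hO => hO.1) hUP
    exact hO.2 U hU hUO
  have hmeet : ∀ O, IsOpen O → (Pᶜ ∩ O).Nonempty → ∃ U ∈ F, U ⊆ O := by
    rintro O hO ⟨x, hxP, hxO⟩
    by_contra! hne
    exact hxP ⟨O, ⟨hO, hne⟩, hxO⟩
  have hirr : IsIrreducible Pᶜ := by
    constructor
    · obtain ⟨x, -, hx⟩ := Set.not_subset.mp (hnP _ huniv)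
      exact ⟨x, hx⟩
    · intro O₁ O₂ h₁ h₂ hn₁ hn₂
      obtain ⟨U, hU, hU₁⟩ := hmeet O₁ h₁ hn₁
      obtain ⟨V, hV, hV₂⟩ := hmeet O₂ h₂ hn₂
      obtain ⟨x, hx, hxP⟩ := Set.not_subset.mp (hnP _ (hinter U hU V hV))
      exact ⟨x, hxP, hU₁ hx.1, hV₂ hx.2⟩
  have := hX.quasiSober
  obtain ⟨x, hx⟩ := QuasiSober.sober hirr hP.isClosed_compl
  refine ⟨x, fun U hU => ?_⟩
  rw [hx.mem_open_set_iff (isOpen_of_mem_KOF hU)]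
  constructor
  · intro h
    obtain ⟨V, hV, hVU⟩ := hmeet U (isOpen_of_mem_KOF hU) h
    exact hup V hV U hU hVU
  · intro h
    obtain ⟨x, hx, hxP⟩ := Set.not_subset.mp (hnP U h)
    exact ⟨x, hxP, hx⟩

/-- A point that is maximal among the points above `x` that avoid the family `𝒵`
is meet-irreducible. -/
theorem exists_isMeetIrreducible_of_family {x : X} {𝒵 : Set (Set X)} (hne : 𝒵.Nonempty)
    (hZ : 𝒵 ⊆ KOF X) (hx : ∀ A ∈ 𝒵, x ∉ A)
    (hfam : ∀ A ∈ 𝒵, ∀ B ∈ 𝒵, ∃ H ∈ KOF X, ∃ D ∈ 𝒵, x ∈ H ∧ A ∩ H ⊆ D ∧ B ∩ H ⊆ D) :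
    ∃ z, IsMeetIrreducible z ∧ SpecLE x z ∧ ∀ A ∈ 𝒵, z ∉ A := by
  obtain ⟨⟨z, hxz, hzZ⟩, hmax⟩ :=
    exists_maximal_of_chains_bounded (α := {z : X // SpecLE x z ∧ ∀ A ∈ 𝒵, z ∉ A})
      (r := fun a b => SpecLE a.1 b.1) (by
        intro c hc
        rcases c.eq_empty_or_nonempty with rfl | ⟨a₀, ha₀⟩
        · exact ⟨⟨x, .refl x, hx⟩, by simp⟩
        -- The supremum of the chain is the point whose filter is the union of the filters of its
        -- elements; it still avoids `𝒵`.
        obtain ⟨p, hp⟩ := hX.exists_point (F := {U | U ∈ KOF X ∧ ∃ a ∈ c, a.1 ∈ U})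
          (fun U hU => hU.1) ⟨hX.univ_mem, a₀, ha₀, Set.mem_univ _⟩
          (by
            rintro U ⟨hU, a, ha, haU⟩ V ⟨hV, b, hb, hbV⟩
            refine ⟨hX.inter_mem hU hV, ?_⟩
            have htot : SpecLE a.1 b.1 ∨ SpecLE b.1 a.1 := by
              by_cases hab : a = b
              · exact .inl (hab ▸ .refl _)
              · exact hc ha hb hab
            rcases htot with h | h
            · exact ⟨b, hb, h.mem_KOF hU haU, hbV⟩
            · exact ⟨a, ha, haU, h.mem_KOF hV hbV⟩)
          (fun U hU V hV hUV => ⟨hV, hU.2.imp fun a ha => ⟨ha.1, hUV ha.2⟩⟩)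
        have hle : ∀ a ∈ c, SpecLE a.1 p := fun a ha =>
          hX.specLE_iff.mpr fun U hU haU => (hp U hU).mpr ⟨hU, a, ha, haU⟩
        refine ⟨⟨p, a₀.2.1.trans (hle a₀ ha₀), fun A hA hpA => ?_⟩, hle⟩
        obtain ⟨-, a, -, haA⟩ := (hp A (hZ hA)).mp hpA
        exact a.2.2 A hA haA)
      (fun h h' => h.trans h')
  refine ⟨z, ⟨fun htop => ?_, fun y w hzy hzw hmeet => ?_⟩, hxz, hzZ⟩
  · obtain ⟨A, hA⟩ := hne
    obtain ⟨y, hy⟩ := (hZ hA).2.2.1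
    exact hzZ A hA ((htop y).mem_KOF (hZ hA) hy)
  -- By maximality, anything strictly above `z` enters `𝒵`. If `y` and `w` both do, the family
  -- condition puts them into one `D ∈ 𝒵`; a lower bound of them in the filter `D` is below `z`,
  -- forcing `z ∈ D`.
  · have key : ∀ y, SpecLE z y → z ≠ y → ∃ A ∈ 𝒵, y ∈ A := by
      intro y hzy hney
      by_contra! hyZ
      exact hney (hX.antisymm hzy (hmax ⟨y, hxz.trans hzy, hyZ⟩ hzy))
    by_contra! hcon
    obtain ⟨A, hA, hyA⟩ := key y hzy hcon.1
    obtain ⟨B, hB, hwB⟩ := key w hzw hcon.2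
    obtain ⟨H, hH, D, hD, hxH, hAD, hBD⟩ := hfam A hA B hB
    have hzH := hxz.mem_KOF hH hxH
    obtain ⟨v, hv, hvy, hvw⟩ := (hZ hD).2.2.2 y (hAD ⟨hyA, hzy.mem_KOF hH hzH⟩)
      w (hBD ⟨hwB, hzw.mem_KOF hH hzH⟩)
    exact hzZ D hD ((hmeet v hvy hvw).mem_KOF (hZ hD) hv)

theorem exists_isMeetIrreducible {x : X} {U : Set X} (hU : U ∈ KOF X) (hx : x ∉ U) :
    ∃ z, IsMeetIrreducible z ∧ SpecLE x z ∧ z ∉ U := by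
  obtain ⟨z, hz, hxz, hzU⟩ := hX.exists_isMeetIrreducible_of_family (x := x) (𝒵 := {U})
    (Set.singleton_nonempty U) (by simpa using hU) (by simpa using hx)
    (by
      rintro _ rfl _ rfl
      exact ⟨Set.univ, hX.univ_mem, _, rfl, Set.mem_univ x, by simp, by simp⟩)
  exact ⟨z, hz, hxz, hzU U rfl⟩

/-- The join of a point and a compact open filter. -/
theorem exists_sup (x : X) {U : Set X} (hU : U ∈ KOF X) :
    ∃ y ∈ U, SpecLE x y ∧ ∀ D ∈ KOF X, y ∈ D → ∃ W ∈ KOF X, x ∈ W ∧ U ∩ W ⊆ D := by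
  -- The filter generated by `U` and the compact open filters containing `x`.
  obtain ⟨y, hy⟩ := hX.exists_point
    (F := {D | D ∈ KOF X ∧ ∃ W ∈ KOF X, x ∈ W ∧ U ∩ W ⊆ D})
    (fun D hD => hD.1) ⟨hX.univ_mem, Set.univ, hX.univ_mem, Set.mem_univ x, Set.subset_univ _⟩
    (by
      rintro D ⟨hD, W, hW, hxW, h⟩ D' ⟨hD', W', hW', hxW', h'⟩
      exact ⟨hX.inter_mem hD hD', W ∩ W', hX.inter_mem hW hW', ⟨hxW, hxW'⟩,
        fun z hz => ⟨h ⟨hz.1, hz.2.1⟩, h' ⟨hz.1, hz.2.2⟩⟩⟩)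
    (by
      rintro D ⟨-, W, hW, hxW, h⟩ D' hD' hDD'
      exact ⟨hD', W, hW, hxW, h.trans hDD'⟩)
  refine ⟨y, (hy U hU).mpr ⟨hU, Set.univ, hX.univ_mem, Set.mem_univ x, Set.inter_subset_left⟩,
    hX.specLE_iff.mpr fun D hD hxD => (hy D hD).mpr ⟨hD, D, hD, hxD, Set.inter_subset_right⟩,
    fun D hD hyD => ((hy D hD).mp hyD).2⟩

/-- The source of axiom (c). The joins of `x` with `U` and with `V` differ from `x`, so by
irreducibility they have a common lower bound `w` not below `x`; `D` separates `w` from `x`. -/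
theorem exists_of_isMeetIrreducible {x : X} (hx : IsMeetIrreducible x) {U V : Set X}
    (hU : U ∈ KOF X) (hV : V ∈ KOF X) (hxU : x ∉ U) (hxV : x ∉ V) :
    ∃ W ∈ KOF X, ∃ D ∈ KOF X, x ∈ W ∧ x ∉ D ∧ U ∩ W ⊆ D ∧ V ∩ W ⊆ D := by
  obtain ⟨y, hyU, hxy, hy⟩ := hX.exists_sup x hU
  obtain ⟨z, hzV, hxz, hz⟩ := hX.exists_sup x hV
  have hw : ∃ w, SpecLE w y ∧ SpecLE w z ∧ ¬ SpecLE w x := by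
    by_contra! hcon
    rcases hx.2 y z hxy hxz hcon with rfl | rfl
    exacts [hxU hyU, hxV hzV]
  obtain ⟨w, hwy, hwz, hwx⟩ := hw
  rw [hX.specLE_iff] at hwx
  push Not at hwx
  obtain ⟨D, hD, hwD, hxD⟩ := hwx
  obtain ⟨W, hW, hxW, h⟩ := hy D hD (hwy.mem_KOF hD hwD)
  obtain ⟨W', hW', hxW', h'⟩ := hz D hD (hwz.mem_KOF hD hwD)
  exact ⟨W ∩ W', hX.inter_mem hW hW', D, hD, ⟨hxW, hxW'⟩, hxD,
    fun v hv => h ⟨hv.1, hv.2.1⟩, fun v hv => h' ⟨hv.1, hv.2.2⟩⟩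

end IsJMSpace

/-! ### The space of unions of subfamilies of `K` -/

namespace SubbasicSpace

variable {C : SubbasicSpace.{u}}

theorem compl_mem_L {U : Set C.carrier} : Uᶜ ∈ C.L ↔ U ∈ C.K := by simp [L]

theorem mem_L {B : Set C.carrier} : B ∈ C.L ↔ Bᶜ ∈ C.K := Iff.rfl

theorem IsCGSpace.empty_mem (hC : C.IsCGSpace) : ∅ ∈ C.K := by
  simpa using hC.sUnion_mem ∅ Set.finite_empty (Set.empty_subset _)

theorem IsCGSpace.union_mem (hC : C.IsCGSpace) {U V : Set C.carrier} (hU : U ∈ C.K)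
    (hV : V ∈ C.K) : U ∪ V ∈ C.K := by
  have h := hC.sUnion_mem {U, V} (Set.toFinite _) (by
    rintro _ (rfl | rfl)
    exacts [hU, hV])
  simpa using h

/-- An ideal of `K` is determined by its union. -/
theorem IsCGSpace.mem_of_subset_sUnion (hC : C.IsCGSpace) {I : Set (Set C.carrier)}
    (hI : I ⊆ C.K) (hempty : ∅ ∈ I) (hunion : ∀ U ∈ I, ∀ V ∈ I, U ∪ V ∈ I)
    (hdown : ∀ U ∈ I, ∀ V ∈ C.K, V ⊆ U → V ∈ I) {U : Set C.carrier} (hU : U ∈ C.K)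
    (h : U ⊆ ⋃₀ I) : U ∈ I := by
  obtain ⟨T, hT, hTfin, hUT⟩ := (hC.isCompact U hU).elim_finite_subcover_image (b := I) (c := id)
    (fun V hV => hC.isOpen V (hI hV)) (by rwa [Set.sUnion_eq_biUnion] at h)
  have key : ⋃₀ T ∈ I := by
    clear hUT
    induction T, hTfin using Set.Finite.induction_on with
    | empty => simpa using hempty
    | @insert a s _ _ ih =>
      rw [Set.sUnion_insert]
      exact hunion a (hT (Set.mem_insert a s)) _ (ih ((Set.subset_insert a s).trans hT))
  exact hdown _ key U hU (by rwa [Set.sUnion_eq_biUnion])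

end SubbasicSpace

namespace HSpace

variable {C : SubbasicSpace.{u}}

/-- The union of a subfamily of `K`, as a point of `HSpace C`. -/
def sUnion {I : Set (Set C.carrier)} (hI : I ⊆ C.K) : HSpace C :=
  ⟨⋃₀ I, I, hI, rfl⟩

/-- The point `U` of `HSpace C`, for `U ∈ K`. -/
def ofK {U : Set C.carrier} (hU : U ∈ C.K) : HSpace C :=
  ⟨U, {U}, by simpa using hU, by simp⟩

theorem ofK_mem_Psi {U : Set C.carrier} (hU : U ∈ C.K) : ofK hU ∈ Psi C U := subset_refl U

theorem subset_of_forall {G H : HSpace C} (h : ∀ U ∈ C.K, U ⊆ G.1 → U ⊆ H.1) : G.1 ⊆ H.1 := by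
  obtain ⟨G, 𝒮, hS, rfl⟩ := G
  exact Set.sUnion_subset fun U hU => h U (hS hU) (Set.subset_sUnion_of_mem hU)

theorem ext_K {G H : HSpace C} (h : ∀ U ∈ C.K, U ⊆ G.1 ↔ U ⊆ H.1) : G = H :=
  Subtype.ext (Set.Subset.antisymm (subset_of_forall fun U hU => (h U hU).mp)
    (subset_of_forall fun U hU => (h U hU).mpr))

theorem Psi_inter (U V : Set C.carrier) : Psi C U ∩ Psi C V = Psi C (U ∪ V) := by
  ext H
  exact Set.union_subset_iff.symm

theorem Psi_empty : Psi C ∅ = Set.univ :=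
  Set.eq_univ_of_forall fun H => Set.empty_subset H.1

theorem specLE_iff {G H : HSpace C} : SpecLE G H ↔ G.1 ⊆ H.1 := by
  rw [specLE_generateFrom_iff (B := Psi C '' C.K) rfl]
  constructor
  · exact fun h => subset_of_forall fun U hU hUG => h _ ⟨U, hU, rfl⟩ hUG
  · rintro h _ ⟨U, _, rfl⟩ hUG
    exact hUG.trans h

theorem isOpen_Psi {U : Set C.carrier} (hU : U ∈ C.K) : IsOpen (Psi C U) :=
  isOpen_generateFrom_of_mem ⟨U, hU, rfl⟩

theorem Psi_subset_Psi {U V : Set C.carrier} (hU : U ∈ C.K) :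
    Psi C U ⊆ Psi C V ↔ V ⊆ U :=
  ⟨fun h => h (ofK_mem_Psi hU), fun h _ hH => h.trans hH⟩

/-- `U` is itself a point of `HSpace C`, and `Psi C U` is the principal filter above it. -/
theorem Psi_mem_KOF {U : Set C.carrier} (hU : U ∈ C.K) : Psi C U ∈ KOF (HSpace C) := by
  have hle : ∀ H ∈ Psi C U, SpecLE (ofK hU) H := fun H hH => specLE_iff.mpr hH
  exact ⟨isCompact_of_forall_specLE (ofK_mem_Psi hU) hle, isOpen_Psi hU, ⟨_, ofK_mem_Psi hU⟩,
    fun G hG H hH => ⟨_, ofK_mem_Psi hU, hle G hG, hle H hH⟩⟩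

theorem isTopologicalBasis (hC : C.IsCGSpace) : IsTopologicalBasis (Psi C '' C.K) where
  exists_subset_inter := by
    rintro _ ⟨U, hU, rfl⟩ _ ⟨V, hV, rfl⟩ H hH
    exact ⟨_, ⟨U ∪ V, hC.union_mem hU hV, rfl⟩, Psi_inter U V ▸ hH, (Psi_inter U V).ge⟩
  sUnion_eq := Set.eq_univ_of_forall fun H =>
    ⟨_, ⟨∅, hC.empty_mem, rfl⟩, Set.empty_subset H.1⟩
  eq_generateFrom := rfl

/-- A compact open filter is covered by the basic sets inside it, hence by supercompactness equals
one of them. -/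
theorem KOF_eq (hC : C.IsCGSpace) : KOF (HSpace C) = Psi C '' C.K := by
  refine Set.Subset.antisymm (fun Q hQ => ?_) ?_
  · obtain ⟨_, ⟨⟨U, hU, rfl⟩, hUQ⟩, hQU⟩ := exists_subset_of_subset_sUnion hQ
      (𝒪 := {O | O ∈ Psi C '' C.K ∧ O ⊆ Q}) (fun O hO => (isTopologicalBasis hC).isOpen hO.1)
      (fun H hH => by
        obtain ⟨O, hO, hHO, hOQ⟩ := (isTopologicalBasis hC).exists_subset_of_mem_open hH hQ.2.1
        exact ⟨O, ⟨hO, hOQ⟩, hHO⟩)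
    exact ⟨U, hU, Set.Subset.antisymm hUQ hQU⟩
  · rintro _ ⟨U, hU, rfl⟩
    exact Psi_mem_KOF hU

theorem quasiSober (hC : C.IsCGSpace) : QuasiSober (HSpace C) where
  sober {Z} hZ hZc := by
    -- Irreducibility of `Z` makes `I` an ideal of `K`, so compactness recovers `I` from its union,
    -- which is the generic point.
    set I : Set (Set C.carrier) := {U | U ∈ C.K ∧ (Z ∩ Psi C U).Nonempty}
    have hIK : I ⊆ C.K := fun V hV => hV.1
    have hI : ∀ {U}, U ∈ C.K → U ⊆ ⋃₀ I → U ∈ I := fun {U} hU h =>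
      hC.mem_of_subset_sUnion (I := I) (fun V hV => hV.1)
        ⟨hC.empty_mem, by simpa [Psi_empty] using hZ.1⟩
        (fun V hV W hW => ⟨hC.union_mem hV.1 hW.1, by
          rw [← Psi_inter]
          exact hZ.2 _ _ (isOpen_Psi hV.1) (isOpen_Psi hW.1) hV.2 hW.2⟩)
        (fun V hV W hW hWV => ⟨hW, hV.2.mono
          (Set.inter_subset_inter_right Z ((Psi_subset_Psi hV.1).mpr hWV))⟩) hU h
    refine ⟨sUnion hIK, ?_⟩
    rw [isGenericPoint_iff_specializes]
    intro G
    constructor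
    · intro h
      refine h.mem_closed hZc ?_
      by_contra hne
      obtain ⟨_, ⟨U, hU, rfl⟩, hIU, hUZ⟩ :=
        (isTopologicalBasis hC).exists_subset_of_mem_open hne hZc.isOpen_compl
      obtain ⟨H, hHZ, hH⟩ := (hI hU hIU).2
      exact hUZ hH hHZ
    · intro hG
      exact specLE_iff.mpr (subset_of_forall fun U hU hUG =>
        Set.subset_sUnion_of_mem ⟨hU, G, hG, hUG⟩)

theorem isJMSpace (hC : C.IsCGSpace) : IsJMSpace (HSpace C) where
  t0 := ⟨fun G H h => Subtype.ext (Set.Subset.antisymm (specLE_iff.mp h.specializes')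
    (specLE_iff.mp h.specializes))⟩
  quasiSober := quasiSober hC
  basis := KOF_eq hC ▸ isTopologicalBasis hC
  sInter_mem 𝒮 hfin hS := by
    rw [KOF_eq hC] at hS ⊢
    induction 𝒮, hfin using Set.Finite.induction_on with
    | empty => exact ⟨∅, hC.empty_mem, by rw [Psi_empty, Set.sInter_empty]⟩
    | @insert a s _ _ ih =>
      obtain ⟨U, hU, rfl⟩ := hS (Set.mem_insert a s)
      obtain ⟨V, hV, h⟩ := ih ((Set.subset_insert _ s).trans hS)
      rw [Set.sInter_insert, ← h, Psi_inter]
      exact ⟨_, hC.union_mem hU hV, rfl⟩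

end HSpace

section MapOfRel

variable {C₁ C₂ : SubbasicSpace.{u}} {S : C₁.carrier → C₂.carrier → Prop}

theorem mem_compl_box {V : Set C₂.carrier} {x : C₁.carrier} :
    x ∈ (box S Vᶜ)ᶜ ↔ ∃ y ∈ V, S x y := by
  simp [box, and_comm]

/-- The sets `V ∈ K₂` with `S⁻¹[V] ⊆ H` form an ideal, so a compact `U` below their union is one of
them. -/
theorem subset_mapOfRel_iff (h₂ : C₂.IsCGSpace) {U : Set C₂.carrier} (hU : U ∈ C₂.K)
    {H : HSpace C₁} : U ⊆ (mapOfRel S H).1 ↔ (box S Uᶜ)ᶜ ⊆ H.1 := by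
  constructor
  · intro h
    have := h₂.mem_of_subset_sUnion (I := {V | V ∈ C₂.K ∧ {x | ∃ y ∈ V, S x y} ⊆ H.1})
      (fun V hV => hV.1) ⟨h₂.empty_mem, by simp⟩
      (fun V hV W hW => ⟨h₂.union_mem hV.1 hW.1, by
        rintro x ⟨y, hy | hy, hxy⟩
        exacts [hV.2 ⟨y, hy, hxy⟩, hW.2 ⟨y, hy, hxy⟩]⟩)
      (fun V hV W hW hWV => ⟨hW, fun x ⟨y, hy, hxy⟩ => hV.2 ⟨y, hWV hy, hxy⟩⟩) hU h
    exact fun x hx => this.2 (mem_compl_box.mp hx)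
  · exact fun h => Set.subset_sUnion_of_mem ⟨hU, fun x hx => h (mem_compl_box.mpr hx)⟩

theorem preimage_mapOfRel_Psi (h₂ : C₂.IsCGSpace) {U : Set C₂.carrier} (hU : U ∈ C₂.K) :
    mapOfRel S ⁻¹' Psi C₂ U = Psi C₁ (box S Uᶜ)ᶜ := by
  ext H
  exact subset_mapOfRel_iff h₂ hU

theorem IsCGMorphism.compl_box_mem (hS : IsCGMorphism C₁ C₂ S) {U : Set C₂.carrier}
    (hU : U ∈ C₂.K) : (box S Uᶜ)ᶜ ∈ C₁.K :=
  hS.box_mem _ (SubbasicSpace.compl_mem_L.mpr hU)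

end MapOfRel

theorem hIsFunctor : HIsFunctor.{u} where
  obj C := HSpace.isJMSpace C.isCG
  map {C₁ C₂} S U hU := by
    rw [HSpace.KOF_eq C₂.isCG] at hU
    obtain ⟨V, hV, rfl⟩ := hU
    rw [preimage_mapOfRel_Psi C₂.isCG hV]
    exact HSpace.Psi_mem_KOF (S.isCG.compl_box_mem hV)
  map_id C := by
    funext H
    refine HSpace.ext_K fun U hU => ?_
    rw [subset_mapOfRel_iff C.isCG hU]
    change (box (idRel C.space) Uᶜ)ᶜ ⊆ H.1 ↔ _
    rw [box_idRel C.isCG (SubbasicSpace.compl_mem_L.mpr hU), compl_compl]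
  map_comp {C₁ C₂ C₃} S T := by
    funext H
    refine HSpace.ext_K fun U hU => ?_
    rw [subset_mapOfRel_iff C₃.isCG hU, subset_mapOfRel_iff C₃.isCG hU,
      subset_mapOfRel_iff C₂.isCG (T.isCG.compl_box_mem hU), compl_compl]
    change (box (starComp C₃.space S.rel T.rel) Uᶜ)ᶜ ⊆ H.1 ↔ _
    rw [box_starComp C₃.isCG _ _ (SubbasicSpace.compl_mem_L.mpr hU)]

/-! ### Restriction of `H` -/

/-- The largest member of `K` below `U` and `V`, in the case of objects of `CG`. -/
def meetK (C : SubbasicSpace.{u}) (U V : Set C.carrier) : Set C.carrier :=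
  ⋃₀ {W | W ∈ C.K ∧ W ⊆ U ∩ V}

theorem meetK_subset {C : SubbasicSpace.{u}} (U V : Set C.carrier) : meetK C U V ⊆ U ∩ V :=
  Set.sUnion_subset fun _ hW => hW.2

theorem delta_compl_union_compl {C : SubbasicSpace.{u}} (U V : Set C.carrier) :
    C.delta (Uᶜ ∪ Vᶜ) = (meetK C U V)ᶜ := by
  ext x
  constructor
  · rintro hx ⟨W, ⟨hW, hWUV⟩, hxW⟩
    refine hx Wᶜ ⟨SubbasicSpace.compl_mem_L.mpr hW, ?_⟩ hxW
    rw [← Set.compl_inter]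
    exact Set.compl_subset_compl.mpr hWUV
  · intro hx A hA
    by_contra hxA
    refine hx ⟨Aᶜ, ⟨hA.1, ?_⟩, hxA⟩
    rw [← Set.compl_subset_compl, compl_compl, Set.compl_inter]
    exact hA.2

theorem HSpace.fsat_empty {C : SubbasicSpace.{u}} (hL : IsCGLatObj C) :
    fsat (∅ : Set (HSpace C)) = Psi C Set.univ := by
  refine Set.Subset.antisymm
    (fsat_subset (Psi_mem_KOF hL.univ_mem).2 (Set.empty_subset _)) fun H hH U hU => ?_
  obtain ⟨G, hG⟩ := hU.1.2.1
  exact SpecLE.mem_open (specLE_iff.mpr ((Set.subset_univ G.1).trans hH)) hU.1.1 hG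

/-- An open filter containing the points `U` and `V` contains a common lower bound `G`. As a union
of members of `K` inside `U ∩ V`, `G` lies below `meetK C U V`. -/
theorem HSpace.fsat_Psi_union {C : SubbasicSpace.{u}} (hL : IsCGLatObj C)
    {U V : Set C.carrier} (hU : U ∈ C.K) (hV : V ∈ C.K) :
    fsat (Psi C U ∪ Psi C V) = Psi C (meetK C U V) := by
  have hm := meetK_subset U V
  refine Set.Subset.antisymm (fsat_subset (Psi_mem_KOF (hL.meet_mem U hU V hV)).2
    (Set.union_subset ((Psi_subset_Psi hU).mpr (hm.trans Set.inter_subset_left))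
      ((Psi_subset_Psi hV).mpr (hm.trans Set.inter_subset_right)))) fun H hH O hO => ?_
  obtain ⟨G, hG, hGU, hGV⟩ := hO.1.2.2 (ofK hU) (hO.2 (.inl (ofK_mem_Psi hU)))
    (ofK hV) (hO.2 (.inr (ofK_mem_Psi hV)))
  refine SpecLE.mem_open (specLE_iff.mpr ?_) hO.1.1 hG
  refine subset_of_forall fun W hW hWG => ?_
  exact (Set.subset_sUnion_of_mem (show W ∈ {W | W ∈ C.K ∧ W ⊆ U ∩ V} from ⟨hW, Set.subset_inter
    (hWG.trans (specLE_iff.mp hGU)) (hWG.trans (specLE_iff.mp hGV))⟩)).trans hH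

theorem kofBoundedSublattice_hSpace {C : SubbasicSpace.{u}} (hC : C.IsCGSpace)
    (hL : IsCGLatObj C) : KOFBoundedSublattice (HSpace C) where
  top_mem := (HSpace.isJMSpace hC).univ_mem
  bot_mem := HSpace.fsat_empty hL ▸ HSpace.Psi_mem_KOF hL.univ_mem
  inf_mem _ hU _ hV := (HSpace.isJMSpace hC).inter_mem hU hV
  sup_mem U hU V hV := by
    rw [HSpace.KOF_eq hC] at hU hV
    obtain ⟨U, hU, rfl⟩ := hU
    obtain ⟨V, hV, rfl⟩ := hV
    rw [HSpace.fsat_Psi_union hL hU hV]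
    exact HSpace.Psi_mem_KOF (hL.meet_mem U hU V hV)

/-- Preservation of finite joins can be checked on the empty and the binary joins. -/
theorem preservesFiniteJoins_of_binary {X Y : JMSLat.{u}} (hY : KOFBoundedSublattice Y.carrier)
    (f : X ⟶ Y) (hempty : f.toFun ⁻¹' fsat ∅ = fsat ∅)
    (hunion : ∀ U ∈ KOF Y.carrier, ∀ V ∈ KOF Y.carrier,
      f.toFun ⁻¹' fsat (U ∪ V) = fsat (f.toFun ⁻¹' U ∪ f.toFun ⁻¹' V)) :
    PreservesFiniteJoins f := by
  intro 𝒮 hfin hS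
  -- The induction must also carry membership in `KOF`, so that the binary case applies to the
  -- partial join.
  suffices h : fsat (⋃₀ 𝒮) ∈ KOF Y.carrier ∧
      f.toFun ⁻¹' fsat (⋃₀ 𝒮) = fsat (⋃₀ (Set.preimage f.toFun '' 𝒮)) from h.2
  induction 𝒮, hfin using Set.Finite.induction_on with
  | empty => simpa using ⟨hY.bot_mem, hempty⟩
  | @insert a s _ _ ih =>
    obtain ⟨h₁, h₂⟩ := ih ((Set.subset_insert a s).trans hS)
    have ha := hS (Set.mem_insert a s)
    rw [Set.sUnion_insert, Set.image_insert_eq, Set.sUnion_insert, ← fsat_union_fsat a,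
      ← fsat_union_fsat (f.toFun ⁻¹' a), ← h₂]
    exact ⟨hY.sup_mem a ha _ h₁, hunion a ha _ h₁⟩

theorem restrictsTo_functorH : RestrictsTo (functorH hIsFunctor.{u}) CG JM where
  obj C hL := kofBoundedSublattice_hSpace C.isCG hL
  hom {C₁ C₂} S hL₁ hL₂ hS := by
    refine preservesFiniteJoins_of_binary (kofBoundedSublattice_hSpace C₂.isCG hL₂) _ ?_ ?_
    · change mapOfRel S.rel ⁻¹' fsat (∅ : Set (HSpace C₂.space)) = fsat (∅ : Set (HSpace C₁.space))
      rw [HSpace.fsat_empty hL₁, HSpace.fsat_empty hL₂,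
        preimage_mapOfRel_Psi C₂.isCG hL₂.univ_mem]
      congr 1
      refine Set.eq_univ_of_forall fun x => mem_compl_box.mpr ?_
      obtain ⟨y, hy⟩ := hS.serial x
      exact ⟨y, Set.mem_univ y, hy⟩
    · intro U hU V hV
      change U ∈ KOF (HSpace C₂.space) at hU
      change V ∈ KOF (HSpace C₂.space) at hV
      change mapOfRel S.rel ⁻¹' fsat (U ∪ V) = fsat (mapOfRel S.rel ⁻¹' U ∪ mapOfRel S.rel ⁻¹' V)
      rw [HSpace.KOF_eq C₂.isCG] at hU hV
      obtain ⟨U, hU, rfl⟩ := hU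
      obtain ⟨V, hV, rfl⟩ := hV
      have hm : meetK C₂.space U V ∈ C₂.space.K := hL₂.meet_mem U hU V hV
      rw [HSpace.fsat_Psi_union hL₂ hU hV, preimage_mapOfRel_Psi C₂.isCG hU,
        preimage_mapOfRel_Psi C₂.isCG hV, preimage_mapOfRel_Psi C₂.isCG hm,
        HSpace.fsat_Psi_union hL₁ (S.isCG.compl_box_mem hU) (S.isCG.compl_box_mem hV)]
      congr 1
      rw [compl_eq_comm, ← delta_compl_union_compl, compl_compl, compl_compl]
      refine Set.Subset.antisymm (fun x hx => hx _ ⟨S.isCG.box_mem _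
        (SubbasicSpace.compl_mem_L.mpr hm), Set.union_subset (box_mono _ ?_) (box_mono _ ?_)⟩) ?_
      · exact Set.compl_subset_compl.mpr ((meetK_subset U V).trans Set.inter_subset_left)
      · exact Set.compl_subset_compl.mpr ((meetK_subset U V).trans Set.inter_subset_right)
      · rw [← delta_compl_union_compl]
        exact hS.box_join _ (SubbasicSpace.compl_mem_L.mpr hU) _
          (SubbasicSpace.compl_mem_L.mpr hV)

/-! ### The space of meet-irreducible points -/

/-- The set of meet-irreducible points in `U`. -/
def irrSet {X : Type u} [TopologicalSpace X] (U : Set X) : Set (meetIrrSpace X).carrier :=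
  {x | x.1 ∈ U}

section MeetIrr

variable {X : Type u} [TopologicalSpace X]

theorem mem_K_meetIrrSpace {V : Set (meetIrrSpace X).carrier} :
    V ∈ (meetIrrSpace X).K ↔ ∃ U ∈ KOF X, V = (irrSet U)ᶜ := Iff.rfl

theorem mem_L_meetIrrSpace {B : Set (meetIrrSpace X).carrier} :
    B ∈ (meetIrrSpace X).L ↔ ∃ U ∈ KOF X, B = irrSet U := by
  rw [SubbasicSpace.mem_L, mem_K_meetIrrSpace]
  simp only [compl_inj_iff]

theorem irrSet_mem_L {U : Set X} (hU : U ∈ KOF X) : irrSet U ∈ (meetIrrSpace X).L :=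
  mem_L_meetIrrSpace.mpr ⟨U, hU, rfl⟩

theorem compl_irrSet_mem_K {U : Set X} (hU : U ∈ KOF X) : (irrSet U)ᶜ ∈ (meetIrrSpace X).K :=
  ⟨U, hU, rfl⟩

theorem irrSet_inter (U V : Set X) : irrSet (U ∩ V) = irrSet U ∩ irrSet V := rfl

theorem irrSet_mono {U V : Set X} (h : U ⊆ V) : irrSet U ⊆ irrSet V := fun _ hx => h hx

theorem irrSet_univ : irrSet (Set.univ : Set X) = Set.univ := rfl

namespace IsJMSpace

variable (hX : IsJMSpace X)

include hX

/-- If `x ∉ U`, a maximal point above `x` outside `U` is meet-irreducible. -/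
theorem mem_iff_forall_irr {x : X} {U : Set X} (hU : U ∈ KOF X) :
    x ∈ U ↔ ∀ z : (meetIrrSpace X).carrier, SpecLE x z.1 → z ∈ irrSet U := by
  refine ⟨fun hx z hz => hz.mem_KOF hU hx, fun h => ?_⟩
  by_contra hx
  obtain ⟨z, hz, hxz, hzU⟩ := hX.exists_isMeetIrreducible hU hx
  exact hzU (h ⟨z, hz⟩ hxz)

/-- A filter of compact open filters is determined by the meet-irreducible points it contains. -/
theorem mem_of_forall_irr {F : Set (Set X)} (hF : F ⊆ KOF X) (huniv : Set.univ ∈ F)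
    (hinter : ∀ U ∈ F, ∀ V ∈ F, U ∩ V ∈ F)
    (hup : ∀ U ∈ F, ∀ V ∈ KOF X, U ⊆ V → V ∈ F) {U : Set X} (hU : U ∈ KOF X)
    (h : ∀ z : (meetIrrSpace X).carrier, (∀ V ∈ F, z ∈ irrSet V) → z ∈ irrSet U) : U ∈ F := by
  obtain ⟨x, hx⟩ := hX.exists_point hF huniv hinter hup
  rw [← hx U hU, hX.mem_iff_forall_irr hU]
  exact fun z hz => h z fun V hV => hz.mem_KOF (hF hV) ((hx V (hF hV)).mpr hV)

theorem irrSet_subset_irrSet {U V : Set X} (hU : U ∈ KOF X) (hV : V ∈ KOF X) :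
    irrSet U ⊆ irrSet V ↔ U ⊆ V := by
  refine ⟨fun h x hx => ?_, irrSet_mono⟩
  rw [hX.mem_iff_forall_irr hV]
  exact fun z hz => h (hz.mem_KOF hU hx)

theorem idRel_meetIrrSpace (x y : (meetIrrSpace X).carrier) :
    idRel (meetIrrSpace X) x y ↔ SpecLE x.1 y.1 := by
  rw [hX.specLE_iff]
  refine (specLE_generateFrom_iff (X := (meetIrrSpace X).carrier)
    (B := (meetIrrSpace X).K) rfl).trans ?_
  constructor
  · intro h U hU hx
    by_contra hy
    exact h _ (compl_irrSet_mem_K hU) hy hx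
  · rintro h _ ⟨U, hU, rfl⟩ hy hx
    exact hy (h U hU hx)

theorem isCompact_compl_irrSet {U : Set X} (hU : U ∈ KOF X) : IsCompact (irrSet U)ᶜ := by
  refine isCompact_generateFrom (S := (meetIrrSpace X).K) rfl fun P hP hUP => ?_
  -- Alexander's subbase theorem leaves only covers by members of `K`. `F` is the filter generated
  -- by the `W` whose complements occur in the cover; `U ∈ F` yields a finite subcover.
  set F : Set (Set X) := {D | D ∈ KOF X ∧ ∃ T, T.Finite ∧ T ⊆ KOF X ∧
    (∀ W ∈ T, (irrSet W)ᶜ ∈ P) ∧ ⋂₀ T ⊆ D}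
  have key : U ∈ F := by
    refine hX.mem_of_forall_irr (F := F) (fun D hD => hD.1)
      ⟨hX.univ_mem, ∅, by simp⟩ ?_ ?_ hU ?_
    · rintro D ⟨hD, T, hT, hTK, hTP, h⟩ D' ⟨hD', T', hT', hTK', hTP', h'⟩
      refine ⟨hX.inter_mem hD hD', T ∪ T', hT.union hT', Set.union_subset hTK hTK', ?_, ?_⟩
      · rintro W (hW | hW)
        exacts [hTP W hW, hTP' W hW]
      · rw [Set.sInter_union]
        exact Set.inter_subset_inter h h'
    · rintro D ⟨-, T, hT, hTK, hTP, h⟩ D' hD' hDD'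
      exact ⟨hD', T, hT, hTK, hTP, h.trans hDD'⟩
    · intro z hz
      by_contra hzU
      obtain ⟨V, hV, hzV⟩ := hUP hzU
      obtain ⟨W, hW, rfl⟩ := hP hV
      exact hzV (hz W ⟨hW, {W}, Set.finite_singleton W, by simpa using hW,
        fun W' hW' => Set.mem_singleton_iff.mp hW' ▸ hV, by simp⟩)
  obtain ⟨-, T, hT, hTK, hTP, h⟩ := key
  refine ⟨(fun W => (irrSet W)ᶜ) '' T, Set.image_subset_iff.mpr hTP, hT.image _, ?_⟩
  intro z hz
  by_contra hne
  refine hz (h fun W hW => ?_)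
  by_contra hzW
  exact hne ⟨_, ⟨W, hW, rfl⟩, hzW⟩

theorem isCGSpace_meetIrrSpace : (meetIrrSpace X).IsCGSpace where
  subbasis := rfl
  t0 := by
    refine ⟨fun x y h => ?_⟩
    have hle : ∀ {a b : (meetIrrSpace X).carrier}, a ⤳ b → SpecLE a.1 b.1 :=
      fun {a b} hab => (hX.idRel_meetIrrSpace a b).mp hab
    exact Subtype.ext (hX.antisymm (hle h.specializes) (hle h.specializes'))
  sUnion_K := by
    refine Set.eq_univ_of_forall fun z => ?_
    have h := z.2.1
    push Not at h
    obtain ⟨y, hy⟩ := h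
    rw [hX.specLE_iff] at hy
    push Not at hy
    obtain ⟨U, hU, -, hzU⟩ := hy
    exact ⟨_, compl_irrSet_mem_K hU, hzU⟩
  isOpen U hU := isOpen_generateFrom_of_mem hU
  isCompact := by
    rintro _ ⟨U, hU, rfl⟩
    exact hX.isCompact_compl_irrSet hU
  sUnion_mem 𝒮 hfin hS := by
    refine ⟨⋂₀ {U | U ∈ KOF X ∧ (irrSet U)ᶜ ∈ 𝒮}, hX.sInter_mem _ ?_ fun U hU => hU.1, ?_⟩
    -- Each member of `𝒮` comes from only one compact open filter, since `irrSet` is injective on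
    -- `KOF X`.
    · refine Set.Finite.of_finite_image (f := fun U => (irrSet U)ᶜ)
        (hfin.subset (Set.image_subset_iff.mpr fun U hU => hU.2)) ?_
      intro U hU V hV h
      have h' : irrSet U = irrSet V := compl_injective h
      exact Set.Subset.antisymm ((hX.irrSet_subset_irrSet hU.1 hV.1).mp h'.le)
        ((hX.irrSet_subset_irrSet hV.1 hU.1).mp h'.ge)
    · ext z
      constructor
      · rintro ⟨V, hV, hzV⟩ hz
        obtain ⟨U, hU, rfl⟩ := hS hV
        exact hzV (hz U ⟨hU, hV⟩)
      · intro hz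
        by_contra hne
        refine hz fun U hU => ?_
        by_contra hzU
        exact hne ⟨_, hU.2, hzU⟩
  c := by
    rintro _ ⟨U, hU, rfl⟩ _ ⟨V, hV, rfl⟩ x ⟨hxU, hxV⟩
    obtain ⟨W, hW, D, hD, hxW, hxD, hUD, hVD⟩ :=
      hX.exists_of_isMeetIrreducible x.2 hU hV hxU hxV
    refine ⟨_, compl_irrSet_mem_K hW, _, compl_irrSet_mem_K hD, ⟨hxD, fun h => h hxW⟩, ?_⟩
    intro y hy
    by_cases hyW : y.1 ∈ W
    · exact .inl ⟨fun h => hy (hUD ⟨h, hyW⟩), fun h => hy (hVD ⟨h, hyW⟩)⟩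
    · exact .inr hyW
  d := by
    rintro Y 𝒵 hY ⟨⟨A₀, hA₀⟩, hZL, hfam⟩ hne
    -- A `Δ`-closed `Y` contains every meet-irreducible point above this `x`, so the maximality
    -- argument above `x` lands in `Y`.
    obtain ⟨x, hx⟩ := hX.exists_point (F := {U | U ∈ KOF X ∧ Y ⊆ irrSet U}) (fun U hU => hU.1)
      ⟨hX.univ_mem, Set.subset_univ Y⟩
      (fun U hU V hV => ⟨hX.inter_mem hU.1 hV.1, Set.subset_inter hU.2 hV.2⟩)
      (fun U hU V hV hUV => ⟨hV, hU.2.trans (irrSet_mono hUV)⟩)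
    obtain ⟨z, hz, hxz, hzZ⟩ := hX.exists_isMeetIrreducible_of_family (x := x)
      (𝒵 := {U | U ∈ KOF X ∧ irrSet U ∈ 𝒵})
      (by
        obtain ⟨U, hU, rfl⟩ := mem_L_meetIrrSpace.mp (hZL hA₀)
        exact ⟨U, hU, hA₀⟩)
      (fun U hU => hU.1)
      (fun U hU hxU => by
        obtain ⟨y, hyY, hyU⟩ := hne _ hU.2
        exact hyU (((hx U hU.1).mp hxU).2 hyY))
      (by
        rintro U ⟨hU, hUZ⟩ V ⟨hV, hVZ⟩
        obtain ⟨H, hH, D, hD, hYH, hUD, hVD⟩ := hfam _ hUZ _ hVZ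
        obtain ⟨H, hHK, rfl⟩ := mem_L_meetIrrSpace.mp hH
        obtain ⟨D, hDK, rfl⟩ := mem_L_meetIrrSpace.mp (hZL hD)
        rw [← irrSet_inter, hX.irrSet_subset_irrSet (hX.inter_mem hU hHK) hDK] at hUD
        rw [← irrSet_inter, hX.irrSet_subset_irrSet (hX.inter_mem hV hHK) hDK] at hVD
        exact ⟨H, hHK, D, ⟨hDK, hD⟩, (hx H hHK).mpr ⟨hHK, hYH⟩, hUD, hVD⟩)
    refine ⟨⟨z, hz⟩, ?_, ?_⟩
    · rw [← hY]
      rintro A ⟨hA, hYA⟩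
      obtain ⟨U, hU, rfl⟩ := mem_L_meetIrrSpace.mp hA
      exact hxz.mem_KOF hU ((hx U hU).mpr ⟨hU, hYA⟩)
    · refine Set.mem_iInter₂.mpr fun A hA => ?_
      obtain ⟨U, hU, rfl⟩ := mem_L_meetIrrSpace.mp (hZL hA)
      exact hzZ U ⟨hU, hA⟩

end IsJMSpace

end MeetIrr

theorem box_relOfMap {X Y : JMSLat.{u}} (f : X ⟶ Y) {U : Set Y.carrier}
    (hU : U ∈ KOF Y.carrier) :
    box (relOfMap f.toFun) (irrSet U) = irrSet (f.toFun ⁻¹' U) := by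
  ext x
  exact (Y.isJM.mem_iff_forall_irr hU).symm

theorem isCGMorphism_relOfMap {X Y : JMSLat.{u}} (f : X ⟶ Y) :
    IsCGMorphism (meetIrrSpace X.carrier) (meetIrrSpace Y.carrier) (relOfMap f.toFun) where
  box_mem B hB := by
    obtain ⟨U, hU, rfl⟩ := mem_L_meetIrrSpace.mp hB
    rw [box_relOfMap f hU]
    exact irrSet_mem_L (f.preimage_mem U hU)
  isDeltaClosed x := by
    refine Set.Subset.antisymm (fun y hy => ?_) (SubbasicSpace.subset_delta _ _)
    refine Y.isJM.specLE_iff.mpr fun U hU hxU => ?_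
    exact hy (irrSet U) ⟨irrSet_mem_L hU, fun z hz => SpecLE.mem_KOF hz hU hxU⟩

theorem mIsFunctor : MIsFunctor.{u} where
  obj X := X.isJM.isCGSpace_meetIrrSpace
  map f := isCGMorphism_relOfMap f
  map_id X := by
    funext x y
    exact propext (X.isJM.idRel_meetIrrSpace x y).symm
  map_comp {X Y Z} f g := by
    have hX := X.isJM.isCGSpace_meetIrrSpace
    have hY := Y.isJM.isCGSpace_meetIrrSpace
    have hZ := Z.isJM.isCGSpace_meetIrrSpace
    have h : (⟨_, isCGMorphism_relOfMap (f ≫ g)⟩ : CGSLat.Hom ⟨_, hX⟩ ⟨_, hZ⟩) =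
        ⟨_, starComp_isCGMorphism hZ (isCGMorphism_relOfMap f) (isCGMorphism_relOfMap g)⟩ := by
      refine CGSLat.Hom.ext_box fun B hB => ?_
      obtain ⟨U, hU, rfl⟩ := mem_L_meetIrrSpace.mp hB
      rw [box_relOfMap (f ≫ g) hU, box_starComp hZ _ _ (irrSet_mem_L hU), box_relOfMap g hU,
        box_relOfMap f (g.preimage_mem U hU)]
      rfl
    exact congrArg CGSLat.Hom.rel h

/-! ### Restriction of `M` -/

/-- Both sides are the join in `L`: a compact open filter including `U` and `V` includes `fsat (U ∪
V)`. -/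
theorem delta_irrSet_union {X : Type u} [TopologicalSpace X] (hX : IsJMSpace X) {U V : Set X}
    (hU : U ∈ KOF X) (hV : V ∈ KOF X) (hUV : fsat (U ∪ V) ∈ KOF X) :
    (meetIrrSpace X).delta (irrSet U ∪ irrSet V) = irrSet (fsat (U ∪ V)) := by
  have hle := subset_fsat (U ∪ V)
  refine Set.Subset.antisymm (fun x hx => hx _ ⟨irrSet_mem_L hUV, Set.union_subset
    (irrSet_mono (Set.subset_union_left.trans hle))
    (irrSet_mono (Set.subset_union_right.trans hle))⟩) ?_
  rintro x hx A ⟨hA, hsub⟩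
  obtain ⟨D, hD, rfl⟩ := mem_L_meetIrrSpace.mp hA
  rw [Set.union_subset_iff, hX.irrSet_subset_irrSet hU hD, hX.irrSet_subset_irrSet hV hD] at hsub
  exact fsat_subset hD.2 (Set.union_subset hsub.1 hsub.2) hx

theorem specLE_of_mem_fsat_empty {X : Type u} [TopologicalSpace X] (hX : IsJMSpace X) {x : X}
    (hx : x ∈ fsat ∅) (y : X) : SpecLE y x :=
  hX.specLE_iff.mpr fun U hU _ => hx U ⟨hU.2, Set.empty_subset U⟩

theorem isCGLatObj_meetIrrSpace {X : Type u} [TopologicalSpace X] (hX : IsJMSpace X)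
    (hL : KOFBoundedSublattice X) : IsCGLatObj (meetIrrSpace X) where
  -- Points of `fsat ∅` are top elements, which are never meet-irreducible.
  univ_mem := ⟨fsat ∅, hL.bot_mem, (Set.eq_univ_of_forall fun x hx =>
    x.2.1 (specLE_of_mem_fsat_empty hX hx)).symm⟩
  meet_mem := by
    rintro _ ⟨U, hU, rfl⟩ _ ⟨V, hV, rfl⟩
    have hUV := hL.sup_mem U hU V hV
    have h : (meetK (meetIrrSpace X) (irrSet U)ᶜ (irrSet V)ᶜ)ᶜ = irrSet (fsat (U ∪ V)) := by
      rw [← delta_compl_union_compl, compl_compl, compl_compl, delta_irrSet_union hX hU hV hUV]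
    exact ⟨_, hUV, (compl_eq_comm.mp h).symm⟩

theorem isCGLatHom_relOfMap {X Y : JMSLat.{u}} (hX : KOFBoundedSublattice X.carrier)
    (hY : KOFBoundedSublattice Y.carrier) (f : X ⟶ Y) (hf : PreservesFiniteJoins f) :
    IsCGLatHom (meetIrrSpace X.carrier) (meetIrrSpace Y.carrier) (relOfMap f.toFun) where
  serial x := by
    have h := hf ∅ Set.finite_empty (Set.empty_subset _)
    rw [Set.image_empty, Set.sUnion_empty, Set.sUnion_empty] at h
    have hx : f.toFun x.1 ∉ fsat ∅ := fun hx =>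
      x.2.1 (specLE_of_mem_fsat_empty X.isJM (h.subset hx))
    obtain ⟨z, hz, hxz, -⟩ := Y.isJM.exists_isMeetIrreducible hY.bot_mem hx
    exact ⟨⟨z, hz⟩, hxz⟩
  box_join B₁ hB₁ B₂ hB₂ := by
    obtain ⟨U, hU, rfl⟩ := mem_L_meetIrrSpace.mp hB₁
    obtain ⟨V, hV, rfl⟩ := mem_L_meetIrrSpace.mp hB₂
    have hUV := hY.sup_mem U hU V hV
    have h := hf {U, V} (Set.toFinite _) (by
      rintro _ (rfl | rfl)
      exacts [hU, hV])
    rw [Set.image_pair, Set.sUnion_pair, Set.sUnion_pair] at h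
    rw [delta_irrSet_union Y.isJM hU hV hUV, box_relOfMap f hUV, box_relOfMap f hU,
      box_relOfMap f hV, delta_irrSet_union X.isJM (f.preimage_mem U hU) (f.preimage_mem V hV)
        (hX.sup_mem _ (f.preimage_mem U hU) _ (f.preimage_mem V hV)), h]

theorem restrictsTo_functorM : RestrictsTo (functorM mIsFunctor.{u}) JM CG where
  obj X hL := isCGLatObj_meetIrrSpace X.isJM hL
  hom f hX hY hf := isCGLatHom_relOfMap hX hY f hf

/-! ### Isomorphisms of subcategories -/

/-- An isomorphism of `C` whose two directions lie in the subcategory `S`. -/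
def Subcat.isoMk {C : Type*} [Category C] {S : Subcat C} {X Y : S.Obj} (e : X.val ≅ Y.val)
    (h : S.hom e.hom) (h' : S.hom e.inv) : X ≅ Y where
  hom := ⟨e.hom, h⟩
  inv := ⟨e.inv, h'⟩
  hom_inv_id := Subtype.ext e.hom_inv_id
  inv_hom_id := Subtype.ext e.inv_hom_id

theorem JMSLat.Hom.continuous {X Y : JMSLat.{u}} (f : X ⟶ Y) : Continuous f.toFun :=
  Y.isJM.basis.continuous_iff.mpr fun U hU => isOpen_of_mem_KOF (f.preimage_mem U hU)

theorem preimage_mem_OF {X Y : Type u} [TopologicalSpace X] [TopologicalSpace Y]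
    {f : X → Y} {g : Y → X} (hf : Continuous f) (hg : Continuous g)
    (hgf : ∀ x, g (f x) = x) (hfg : ∀ y, f (g y) = y) {U : Set Y} (hU : U ∈ OF Y) :
    f ⁻¹' U ∈ OF X := by
  obtain ⟨hUo, ⟨y, hy⟩, hdir⟩ := hU
  refine ⟨hUo.preimage hf, ⟨g y, by simpa [hfg] using hy⟩, fun a ha b hb => ?_⟩
  obtain ⟨z, hz, hza, hzb⟩ := hdir _ ha _ hb
  refine ⟨g z, by simpa [hfg] using hz, ?_, ?_⟩
  · exact hgf a ▸ Specializes.map hza hg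
  · exact hgf b ▸ Specializes.map hzb hg

/-- A homeomorphism matches the open filters of the two spaces. -/
theorem preimage_fsat {X Y : Type u} [TopologicalSpace X] [TopologicalSpace Y]
    {f : X → Y} {g : Y → X} (hf : Continuous f) (hg : Continuous g)
    (hgf : ∀ x, g (f x) = x) (hfg : ∀ y, f (g y) = y) (A : Set Y) :
    f ⁻¹' fsat A = fsat (f ⁻¹' A) := by
  ext x
  constructor
  · intro hx U hU
    have h := hx (g ⁻¹' U) ⟨preimage_mem_OF hg hf hfg hgf hU.1,
      fun y hy => hU.2 (by simpa [hfg] using hy)⟩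
    simpa [hgf] using h
  · intro hx U hU
    exact hx (f ⁻¹' U) ⟨preimage_mem_OF hf hg hgf hfg hU.1, Set.preimage_mono hU.2⟩

theorem preservesFiniteJoins_iso {X Y : JMSLat.{u}} (e : X ≅ Y) : PreservesFiniteJoins e.hom := by
  intro 𝒮 _ _
  rw [preimage_fsat e.hom.continuous e.inv.continuous
    (fun x => congrFun (congrArg JMSLat.Hom.toFun e.hom_inv_id) x)
    (fun y => congrFun (congrArg JMSLat.Hom.toFun e.inv_hom_id) y), Set.preimage_sUnion,
    Set.sUnion_image]

theorem box_box_of_comp_eq_id {C D : CGSLat.{u}} {f : C ⟶ D} {g : D ⟶ C} (h : f ≫ g = 𝟙 C)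
    {B : Set C.space.carrier} (hB : B ∈ C.space.L) : box f.rel (box g.rel B) = B := by
  have h' : starComp C.space f.rel g.rel = idRel C.space := congrArg CGSLat.Hom.rel h
  rw [← box_starComp C.isCG _ _ hB, h', box_idRel C.isCG hB]

/-- The boxes of `e` and its inverse are mutually inverse monotone maps between the families `L`, so
they preserve the empty set and joins. -/
theorem isCGLatHom_iso {C D : CGSLat.{u}} (hC : IsCGLatObj C.space)
    (e : C ≅ D) : IsCGLatHom C.space D.space e.hom.rel where
  serial x := by
    by_contra! hne
    have hx : x ∈ box e.hom.rel ∅ := fun y hy => (hne y hy).elim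
    have hx' := box_mono e.hom.rel (Set.empty_subset (box e.inv.rel ∅)) hx
    rwa [box_box_of_comp_eq_id e.hom_inv_id hC.empty_mem] at hx'
  box_join B₁ hB₁ B₂ hB₂ x hx A := by
    rintro ⟨hA, hsub⟩
    rw [← box_box_of_comp_eq_id e.hom_inv_id hA]
    have key : ∀ B ∈ D.space.L, box e.hom.rel B ⊆ A → B ⊆ box e.inv.rel A := by
      intro B hB h
      rw [← box_box_of_comp_eq_id e.inv_hom_id hB]
      exact box_mono _ h
    refine box_mono _ (fun y hy => ?_) hx
    exact hy _ ⟨e.inv.isCG.box_mem A hA, Set.union_subset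
      (key B₁ hB₁ (Set.subset_union_left.trans hsub))
      (key B₂ hB₂ (Set.subset_union_right.trans hsub))⟩

/-! ### The unit -/

section Unit

variable (C : CGSLat.{u})

/-- `x` is related to the meet-irreducible `P` iff `P` contains all `U ∈ K` with `x ∉ U`. -/
def unitRel (x : C.space.carrier) (P : (meetIrrSpace (HSpace C.space)).carrier) : Prop :=
  ∀ U ∈ C.space.K, x ∉ U → P ∈ irrSet (Psi C.space U)

/-- The meet-irreducible `P` is related to the points outside `P`. -/
def unitInvRel (P : (meetIrrSpace (HSpace C.space)).carrier) (x : C.space.carrier) : Prop :=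
  x ∉ P.1.1

variable {C}

theorem mem_L_meetIrrSpace_hSpace {B : Set (meetIrrSpace (HSpace C.space)).carrier} :
    B ∈ (meetIrrSpace (HSpace C.space)).L ↔
      ∃ U ∈ C.space.K, B = irrSet (Psi C.space U) := by
  rw [mem_L_meetIrrSpace, HSpace.KOF_eq C.isCG]
  simp

theorem box_unitRel {U : Set C.space.carrier} (hU : U ∈ C.space.K) :
    box (unitRel C) (irrSet (Psi C.space U)) = Uᶜ := by
  ext x
  refine ⟨fun hx hxU => ?_, fun hx P hP => hP U hU hx⟩
  -- The meet-irreducibles above `G` are all related to `x`; if they all lie in `Psi C.space U`,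
  -- then so does `G`, although `x ∈ U` is outside `G`.
  let G : HSpace C.space := HSpace.sUnion (I := {V | V ∈ C.space.K ∧ x ∉ V}) fun V hV => hV.1
  have hxG : x ∉ G.1 := fun ⟨V, hV, hxV⟩ => hV.2 hxV
  have hG : G ∈ Psi C.space U := by
    rw [(HSpace.isJMSpace C.isCG).mem_iff_forall_irr (HSpace.Psi_mem_KOF hU)]
    refine fun P hP => hx P fun V hV hxV => ?_
    exact (Set.subset_sUnion_of_mem (S := {V | V ∈ C.space.K ∧ x ∉ V}) ⟨hV, hxV⟩).trans
      (HSpace.specLE_iff.mp hP)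
  exact hxG (hG hxU)

theorem box_unitInvRel (U : Set C.space.carrier) :
    box (unitInvRel C) Uᶜ = irrSet (Psi C.space U) := by
  ext P
  exact Set.compl_subset_compl

theorem isCGMorphism_unitRel :
    IsCGMorphism C.space (meetIrrSpace (HSpace C.space)) (unitRel C) where
  box_mem B hB := by
    obtain ⟨U, hU, rfl⟩ := mem_L_meetIrrSpace_hSpace.mp hB
    rw [box_unitRel hU]
    exact SubbasicSpace.compl_mem_L.mpr hU
  isDeltaClosed x := by
    refine Set.Subset.antisymm (fun P hP U hU hxU => ?_) (SubbasicSpace.subset_delta _ _)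
    exact hP _ ⟨irrSet_mem_L (HSpace.Psi_mem_KOF hU), fun Q hQ => hQ U hU hxU⟩

theorem isCGMorphism_unitInvRel :
    IsCGMorphism (meetIrrSpace (HSpace C.space)) C.space (unitInvRel C) where
  box_mem B hB := by
    rw [← compl_compl B, box_unitInvRel]
    exact irrSet_mem_L (HSpace.Psi_mem_KOF hB)
  isDeltaClosed P := by
    refine Set.Subset.antisymm (fun x hx hxP => ?_) (SubbasicSpace.subset_delta _ _)
    obtain ⟨𝒮, hS, h⟩ := P.1.2
    obtain ⟨U, hU, hxU⟩ := h.subset hxP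
    refine hx Uᶜ ⟨SubbasicSpace.compl_mem_L.mpr (hS hU), fun y hy hyU => hy ?_⟩ hxU
    exact h.symm.subset ⟨U, hU, hyU⟩

variable (C)

/-- The isomorphism between a CG-space and its double dual. -/
def unitIso : C ≅ (functorM mIsFunctor).obj ((functorH hIsFunctor).obj C) where
  hom := ⟨unitRel C, isCGMorphism_unitRel⟩
  inv := ⟨unitInvRel C, isCGMorphism_unitInvRel⟩
  hom_inv_id := CGSLat.Hom.ext_box fun B hB => by
    change box (starComp C.space (unitRel C) (unitInvRel C)) B = box (idRel C.space) B
    rw [box_starComp C.isCG _ _ hB, box_idRel C.isCG hB, ← compl_compl B, box_unitInvRel,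
      box_unitRel hB]
  inv_hom_id := CGSLat.Hom.ext_box fun B hB => by
    have hM := (HSpace.isJMSpace C.isCG).isCGSpace_meetIrrSpace
    obtain ⟨U, hU, rfl⟩ := mem_L_meetIrrSpace_hSpace.mp hB
    refine (box_starComp hM (unitInvRel C) (unitRel C) hB).trans ?_
    rw [box_unitRel hU, box_unitInvRel]
    exact (box_idRel hM hB).symm

theorem unitIso_naturality {C D : CGSLat.{u}} (S : C ⟶ D) :
    S ≫ (unitIso D).hom =
      (unitIso C).hom ≫ (functorM mIsFunctor).map ((functorH hIsFunctor).map S) :=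
  CGSLat.Hom.ext_box fun B hB => by
    have hM := (HSpace.isJMSpace D.isCG).isCGSpace_meetIrrSpace
    obtain ⟨U, hU, rfl⟩ := mem_L_meetIrrSpace_hSpace.mp hB
    refine (box_starComp hM S.rel (unitRel D) hB).trans (Eq.trans ?_ (box_starComp hM (unitRel C)
      (relOfMap (mapOfRel S.rel)) hB).symm)
    have h : box (relOfMap (mapOfRel S.rel)) (irrSet (Psi D.space U)) =
        irrSet (Psi C.space (box S.rel Uᶜ)ᶜ) := by
      refine (box_relOfMap ((functorH hIsFunctor).map S) (HSpace.Psi_mem_KOF hU)).trans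
        (congrArg irrSet ?_)
      exact preimage_mapOfRel_Psi D.isCG hU
    rw [h, box_unitRel hU, box_unitRel (S.isCG.compl_box_mem hU), compl_compl]

end Unit

/-! ### The counit -/

section Counit

variable (X : JMSLat.{u})

/-- The map from `X` to its double dual. -/
def toDoubleDual (x : X.carrier) : HSpace (meetIrrSpace X.carrier) :=
  HSpace.sUnion (I := {V | ∃ U ∈ KOF X.carrier, x ∈ U ∧ V = (irrSet U)ᶜ})
    fun _ ⟨U, hU, _, h⟩ => ⟨U, hU, h⟩

variable {X}

theorem compl_irrSet_subset_toDoubleDual {U : Set X.carrier} (hU : U ∈ KOF X.carrier)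
    {x : X.carrier} : (irrSet U)ᶜ ⊆ (toDoubleDual X x).1 ↔ x ∈ U := by
  constructor
  · intro h
    by_contra hx
    obtain ⟨z, hz, hxz, hzU⟩ := X.isJM.exists_isMeetIrreducible hU hx
    obtain ⟨_, ⟨V, hV, hxV, rfl⟩, hzV⟩ := h (show ⟨z, hz⟩ ∈ (irrSet U)ᶜ from hzU)
    exact hzV (hxz.mem_KOF hV hxV)
  · exact fun hx => Set.subset_sUnion_of_mem ⟨U, hU, hx, rfl⟩

theorem preimage_toDoubleDual {U : Set X.carrier} (hU : U ∈ KOF X.carrier) :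
    toDoubleDual X ⁻¹' Psi (meetIrrSpace X.carrier) (irrSet U)ᶜ = U :=
  Set.ext fun _ => compl_irrSet_subset_toDoubleDual hU

theorem mem_KOF_hSpace_meetIrrSpace {Q : Set (HSpace (meetIrrSpace X.carrier))} :
    Q ∈ KOF (HSpace (meetIrrSpace X.carrier)) ↔
      ∃ U ∈ KOF X.carrier, Q = Psi (meetIrrSpace X.carrier) (irrSet U)ᶜ := by
  rw [HSpace.KOF_eq X.isJM.isCGSpace_meetIrrSpace]
  constructor
  · rintro ⟨_, ⟨U, hU, rfl⟩, rfl⟩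
    exact ⟨U, hU, rfl⟩
  · rintro ⟨U, hU, rfl⟩
    exact ⟨_, compl_irrSet_mem_K hU, rfl⟩

theorem bijective_toDoubleDual : Function.Bijective (toDoubleDual X) := by
  have hX := X.isJM
  constructor
  · intro x y h
    refine hX.ext_KOF fun U hU => ?_
    rw [← compl_irrSet_subset_toDoubleDual hU, h, compl_irrSet_subset_toDoubleDual hU]
  · intro H
    -- Complementation turns the ideal of members of `K` below `H` into a filter of `KOF X`, hence a
    -- point.
    obtain ⟨x, hx⟩ := hX.exists_point (F := {U | U ∈ KOF X.carrier ∧ (irrSet U)ᶜ ⊆ H.1})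
      (fun U hU => hU.1) ⟨hX.univ_mem, by simp [irrSet_univ]⟩
      (fun U hU V hV => ⟨hX.inter_mem hU.1 hV.1, by
        rw [irrSet_inter, Set.compl_inter]
        exact Set.union_subset hU.2 hV.2⟩)
      (fun U hU V hV hUV => ⟨hV, (Set.compl_subset_compl.mpr (irrSet_mono hUV)).trans hU.2⟩)
    refine ⟨x, HSpace.ext_K ?_⟩
    rintro _ ⟨U, hU, rfl⟩
    refine (compl_irrSet_subset_toDoubleDual hU).trans ((hx U hU).trans ?_)
    exact ⟨fun h => h.2, fun h => ⟨hU, h⟩⟩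

variable (X)

/-- The map from `X` to its double dual, as a bijection. -/
noncomputable def doubleDualEquiv : X.carrier ≃ HSpace (meetIrrSpace X.carrier) :=
  Equiv.ofBijective (toDoubleDual X) bijective_toDoubleDual

theorem preimage_doubleDualEquiv_symm {U : Set X.carrier} (hU : U ∈ KOF X.carrier) :
    (doubleDualEquiv X).symm ⁻¹' U = Psi (meetIrrSpace X.carrier) (irrSet U)ᶜ := by
  ext H
  obtain ⟨x, rfl⟩ := (doubleDualEquiv X).surjective H
  rw [Set.mem_preimage, Equiv.symm_apply_apply]
  exact (compl_irrSet_subset_toDoubleDual hU).symm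

/-- The isomorphism between a JM-space and its double dual. -/
noncomputable def counitIso :
    (functorH hIsFunctor).obj ((functorM mIsFunctor).obj X) ≅ X where
  hom := ⟨(doubleDualEquiv X).symm, fun U hU =>
    mem_KOF_hSpace_meetIrrSpace.mpr ⟨U, hU, preimage_doubleDualEquiv_symm X hU⟩⟩
  inv := ⟨doubleDualEquiv X, fun Q hQ => by
    obtain ⟨U, hU, rfl⟩ := mem_KOF_hSpace_meetIrrSpace.mp hQ
    exact (preimage_toDoubleDual hU).symm ▸ hU⟩
  hom_inv_id := JMSLat.Hom.ext (funext fun H => (doubleDualEquiv X).apply_symm_apply H)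
  inv_hom_id := JMSLat.Hom.ext (funext fun x => (doubleDualEquiv X).symm_apply_apply x)

/-- Naturality is checked in this direction because `toDoubleDual` is explicit, whereas its inverse
comes only from bijectivity. -/
theorem counitIso_inv_naturality {X Y : JMSLat.{u}} (f : X ⟶ Y) :
    f ≫ (counitIso Y).inv =
      (counitIso X).inv ≫ (functorH hIsFunctor).map ((functorM mIsFunctor).map f) := by
  refine JMSLat.Hom.ext (funext fun x => ?_)
  change toDoubleDual Y (f.toFun x) = mapOfRel (relOfMap f.toFun) (toDoubleDual X x)
  refine HSpace.ext_K ?_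
  rintro _ ⟨U, hU, rfl⟩
  refine (compl_irrSet_subset_toDoubleDual hU).trans (Iff.symm ?_)
  refine (subset_mapOfRel_iff Y.isJM.isCGSpace_meetIrrSpace (compl_irrSet_mem_K hU)).trans ?_
  rw [compl_compl, box_relOfMap f hU]
  exact compl_irrSet_subset_toDoubleDual (f.preimage_mem U hU)

theorem counitIso_naturality {X Y : JMSLat.{u}} (f : X ⟶ Y) :
    (functorH hIsFunctor).map ((functorM mIsFunctor).map f) ≫ (counitIso Y).hom =
      (counitIso X).hom ≫ f := by
  rw [← Iso.inv_comp_eq, ← Category.assoc, ← counitIso_inv_naturality, Category.assoc,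
    Iso.inv_hom_id, Category.comp_id]

end Counit

/-- The equivalence between `CG` and `JM`. -/
noncomputable def equivalenceCGJM : CG.{u}.Obj ≌ JM.{u}.Obj :=
  CategoryTheory.Equivalence.mk (restrict (functorH hIsFunctor) restrictsTo_functorH)
    (restrict (functorM mIsFunctor) restrictsTo_functorM)
    (NatIso.ofComponents
      (fun C => Subcat.isoMk (unitIso C.val)
        (isCGLatHom_iso C.property (unitIso C.val))
        (isCGLatHom_iso (isCGLatObj_meetIrrSpace (HSpace.isJMSpace C.val.isCG)
          (kofBoundedSublattice_hSpace C.val.isCG C.property)) (unitIso C.val).symm))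
      (fun S => Subtype.ext (unitIso_naturality S.1)))
    (NatIso.ofComponents
      (fun X => Subcat.isoMk (counitIso X.val) (preservesFiniteJoins_iso (counitIso X.val))
        (preservesFiniteJoins_iso (counitIso X.val).symm))
      (fun f => Subtype.ext (counitIso_naturality f.1)))

end CGJM

theorem mainTheorem5 :
    ∃ (hM : CGJM.MIsFunctor.{u}) (hH : CGJM.HIsFunctor.{u})
      (rM : CGJM.RestrictsTo (CGJM.functorM hM) CGJM.JM CGJM.CG)
      (rH : CGJM.RestrictsTo (CGJM.functorH hH) CGJM.CG CGJM.JM)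
      (e : CGJM.CG.{u}.Obj ≌ CGJM.JM.{u}.Obj),
      e.functor = CGJM.restrict (CGJM.functorH hH) rH ∧
      e.inverse = CGJM.restrict (CGJM.functorM hM) rM :=
  ⟨CGJM.mIsFunctor, CGJM.hIsFunctor, CGJM.restrictsTo_functorM, CGJM.restrictsTo_functorH,
    CGJM.equivalenceCGJM, rfl, rfl⟩
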